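/- Let $0\le\beta<1$, let $$S_\beta=\{\zeta\in\mathbb C^2:\ \operatorname{Im}\zeta_2=|\zeta_1|^2+\beta\operatorname{Re}(\zeta_1^2)\},\qquad \Omega_\beta=\{z\in\mathbb C^2:\ \operatorname{Im}z_2>|z_1|^2+\beta\operatorname{Re}(z_1^2)\},$$ and let $\sigma=dx_1\,dy_1\,dx_2$ on $S_\beta$, where $\zeta_j=x_j+iy_j$ and $S_\beta$ is parametrized by (and oriented by) $(x_1,y_1,x_2)\in\mathbb R^3$. Let $\rho(\zeta)=|\zeta_1|^2+\beta\operatorname{Re}(\zeta_1^2)-\operatorname{Im}\zeta_2$. For $f\in L^2(S_\beta,\sigma)$ and $z\in\Omega_\beta$ put $$\boldsymbol L_\beta f(z)=\int_{S_\beta}f(\zeta)\,\frac1{(2\pi i)^2}\,\frac{\partial\rho(\zeta)\wedge\bar\partial\partial\rho(\zeta)}{\langle\partial\rho(\zeta),\zeta-z\rangle^2},\qquad \langle\partial\rho(\zeta),v\rangle=\sum_{j=1}^2\frac{\partial\rho}{\partial\zeta_j}(\zeta)\,v_j .$$ Then this integral converges absolutely for every $f\in L^2(S_\beta,\sigma)$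 and $z\in\Omega_\beta$. For every $\varepsilon>0$ the function $z\mapsto \boldsymbol L_\beta f(z_1,z_2+i\varepsilon)$ on $S_\beta$ belongs to $L^2(S_\beta,\sigma)$, and as $\varepsilon\to0^+$ these functions converge in $L^2(S_\beta,\sigma)$ to a boundary value, again denoted $\boldsymbol L_\beta f$. The resulting map, the Leray transform $\boldsymbol L_\beta:L^2(S_\beta,\sigma)\to L^2(S_\beta,\sigma)$, is a bounded linear operator, and its operator norm is exactly $$\|\boldsymbol L_\beta\|_{L^2(S_\beta,\sigma)}=\frac1{\sqrt[4]{1-\beta^2}} .$$ -/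

import Mathlib

open MeasureTheory Filter Topology

noncomputable section

/-! ### Complex calculus in two variables: points of `ℂ²` are maps `Fin 2 → ℂ`,
the coordinates `ζ₁, ζ₂` being `ζ 0, ζ 1`. -/

/-- `∂g/∂ζⱼ = ½ (∂g/∂xⱼ - i ∂g/∂yⱼ)`. -/
def wirtinger (j : Fin 2) (g : (Fin 2 → ℂ) → ℂ) (ζ : Fin 2 → ℂ) : ℂ :=
  (fderiv ℝ g ζ (Pi.single j 1) - Complex.I * fderiv ℝ g ζ (Pi.single j Complex.I)) / 2

/-- `∂g/∂ζ̄ₖ = ½ (∂g/∂xₖ + i ∂g/∂yₖ)`. -/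
def wirtingerBar (k : Fin 2) (g : (Fin 2 → ℂ) → ℂ) (ζ : Fin 2 → ℂ) : ℂ :=
  (fderiv ℝ g ζ (Pi.single k 1) + Complex.I * fderiv ℝ g ζ (Pi.single k Complex.I)) / 2

/-- The `(1,0)`-form `∂ρ = ∑ⱼ (∂ρ/∂ζⱼ) dζⱼ` at `ζ`, evaluated at the vector `v`.
It is also the bilinear pairing `⟨∂ρ(ζ), v⟩`. -/
def dRho (ρ : (Fin 2 → ℂ) → ℝ) (ζ v : Fin 2 → ℂ) : ℂ :=
  ∑ j, wirtinger j (fun w => (ρ w : ℂ)) ζ * v j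

/-- The `(1,1)`-form `∂̄∂ρ = ∑ⱼₖ (∂²ρ/∂ζ̄ₖ∂ζⱼ) dζ̄ₖ ∧ dζⱼ` at `ζ`, evaluated at `(u, v)`. -/
def dBarDRho (ρ : (Fin 2 → ℂ) → ℝ) (ζ u v : Fin 2 → ℂ) : ℂ :=
  ∑ j, ∑ k, wirtingerBar k (wirtinger j (fun w => (ρ w : ℂ))) ζ *
    (star (u k) * v j - star (v k) * u j)

/-- The Leray kernel of a hypersurface of `ℂ²` with defining function `ρ`,
`(2πi)⁻² ∂ρ(ζ) ∧ ∂̄∂ρ(ζ) / ⟨∂ρ(ζ), ζ - z⟩²`, a `3`-form in `ζ`, evaluated at `(u, v, w)`. -/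
def lerayKernel (ρ : (Fin 2 → ℂ) → ℝ) (z ζ u v w : Fin 2 → ℂ) : ℂ :=
  1 / (2 * Real.pi * Complex.I) ^ 2 *
    (dRho ρ ζ u * dBarDRho ρ ζ v w - dRho ρ ζ v * dBarDRho ρ ζ u w
      + dRho ρ ζ w * dBarDRho ρ ζ u v) / (dRho ρ ζ (ζ - z)) ^ 2

/-! ### The model hypersurfaces -/

/-- `S_β = {Im ζ₂ = |ζ₁|² + β Re ζ₁²}`. -/
def modelHypersurface (β : ℝ) : Set (Fin 2 → ℂ) :=
  {ζ | (ζ 1).im = ‖ζ 0‖ ^ 2 + β * (ζ 0 ^ 2).re}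

/-- `Ω_β = {Im z₂ > |z₁|² + β Re z₁²}`. -/
def modelDomain (β : ℝ) : Set (Fin 2 → ℂ) :=
  {z | ‖z 0‖ ^ 2 + β * (z 0 ^ 2).re < (z 1).im}

/-- The defining function `|ζ₁|² + β Re ζ₁² - Im ζ₂` of `S_β`, negative exactly on `Ω_β`. -/
def modelRho (β : ℝ) (ζ : Fin 2 → ℂ) : ℝ :=
  ‖ζ 0‖ ^ 2 + β * (ζ 0 ^ 2).re - (ζ 1).im

/-- The parametrization of `S_β` by `(x₁, y₁, x₂) ∈ ℝ³`, as a map into `ℂ²`. -/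
def modelGraph (β : ℝ) (p : ℝ × ℝ × ℝ) : Fin 2 → ℂ :=
  ![⟨p.1, p.2.1⟩, ⟨p.2.2, ‖(⟨p.1, p.2.1⟩ : ℂ)‖ ^ 2 + β * ((⟨p.1, p.2.1⟩ : ℂ) ^ 2).re⟩]

theorem modelGraph_mem (β : ℝ) (p : ℝ × ℝ × ℝ) : modelGraph β p ∈ modelHypersurface β := by
  simp [modelGraph, modelHypersurface]

/-- The same parametrization as a map onto `S_β`. -/
def modelParam (β : ℝ) (p : ℝ × ℝ × ℝ) : modelHypersurface β :=
  ⟨modelGraph β p, modelGraph_mem β p⟩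

/-- The measure `σ = dx₁ dy₁ dx₂` on `S_β`. -/
def modelMeasure (β : ℝ) : Measure (modelHypersurface β) :=
  Measure.map (modelParam β) volume

/-! ### The Leray transform of `S_β` -/

/-- The coefficient of `dx₁ ∧ dy₁ ∧ dx₂` in the pull-back to `ℝ³` of the `3`-form
`f(ζ) 𝓛(z, ζ)` on `S_β`. -/
def lerayIntegrand (β : ℝ) (f : modelHypersurface β → ℂ) (z : Fin 2 → ℂ)
    (p : ℝ × ℝ × ℝ) : ℂ :=
  f (modelParam β p) * lerayKernel (modelRho β) z (modelGraph β p)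
    (fderiv ℝ (modelGraph β) p (1, 0, 0))
    (fderiv ℝ (modelGraph β) p (0, 1, 0))
    (fderiv ℝ (modelGraph β) p (0, 0, 1))

/-- The Leray integral `∫_{S_β} f(ζ) 𝓛(z, ζ)`, with `S_β` oriented by `dx₁ ∧ dy₁ ∧ dx₂`. -/
def lerayIntegral (β : ℝ) (f : modelHypersurface β → ℂ) (z : Fin 2 → ℂ) : ℂ :=
  ∫ p : ℝ × ℝ × ℝ, lerayIntegrand β f z p

/-- The restriction of `F` to the shell `S_β + (0, iε)`, as a function on `S_β`. -/
def shellRestrict (β : ℝ) (F : (Fin 2 → ℂ) → ℂ) (ε : ℝ) (z : modelHypersurface β) : ℂ :=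
  F ((z : Fin 2 → ℂ) + ![0, ε * Complex.I])

/-- `g` is the `L²(S_β, σ)` boundary value of the function `F` on `Ω_β`. -/
def HasL2BoundaryValue (β : ℝ) (F : (Fin 2 → ℂ) → ℂ) (g : modelHypersurface β → ℂ) : Prop :=
  (∀ ε : ℝ, 0 < ε → MemLp (shellRestrict β F ε) 2 (modelMeasure β)) ∧
  Tendsto (fun ε : ℝ => eLpNorm (shellRestrict β F ε - g) 2 (modelMeasure β))
    (𝓝[>] 0) (𝓝 0)

/-- `L` is the Leray transform of `S_β` on `L²(S_β, σ)`: the Leray integral of every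
`f ∈ L²(S_β, σ)` converges absolutely on `Ω_β`, and `L f` is its boundary value. -/
def IsLerayTransform (β : ℝ)
    (L : Lp ℂ 2 (modelMeasure β) → Lp ℂ 2 (modelMeasure β)) : Prop :=
  ∀ f : Lp ℂ 2 (modelMeasure β),
    (∀ z ∈ modelDomain β, Integrable (lerayIntegrand β f z)) ∧
    HasL2BoundaryValue β (lerayIntegral β f) (L f)

end

/-!
Parametrize `S_β` by `ℝ³`. For `ε > 0` the Leray integral on the shell of height `ε` above `S_β` is
`p ↦ ⟪κ ε p, f⟫` with `κ ε p ∈ L²` the conjugate of the explicit kernel `shellKernel β ε p`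
(`lerayIntegrand_shell`). Everything rests on the Gram matrix of these vectors:
`⟪κ ε p, κ δ q⟫ = g (ε + δ) p q`, where `g a` is `(1 - β²)^(-1/2)` times the Leray kernel for `β = 0`
at height `a`, seen through a measure preserving shear (`integral_shellKernel_mul_conj`). The case
`β = 0` of the same formula then computes the Gram matrix of the functions `γ a q = g a · q`: it is
`(1 - β²)^(-1/2) g (ε + δ) p q` (`integral_conj_gramKernel_mul`).

The operator is now forced (`exists_boundary_operator`). The shell function of `κ δ q` is
`γ (ε + δ) q`, so its boundary value is `γ δ q`. Since the two Gram matrices agree up to the factor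
`c² = (1 - β²)^(-1/2)`, the assignment `κ δ q ↦ γ δ q` extends to `c` times an isometry on the closed
span of all `κ δ q`. On its orthogonal complement all shell functions vanish. Hence the limit
operator has norm exactly `c`. For the convergence one needs the maps `κ δ q ↦ κ (δ + ε) q` to be
contractions: for a finite combination `x`, the norm `u s` of its translate by `s` satisfies
`u s ^ 2 ≤ u 0 * u (2 s)` by Cauchy–Schwarz, because the Gram matrix depends on the sum of the
heights only. As `u` is bounded, this forces `u s ≤ u 0` (`le_apply_zero_of_sq_le`). No singular
integral estimate or Fourier transform enters.

The Gram integral is evaluated by partial fractions in `t` (`integral_inv_sq_mul_inv_sq`), leaving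
the integral over the plane of the inverse cube of a complex quadratic polynomial, which is a
Laplace transform of Gaussian integrals (`integral_inv_quadratic_cube`).
-/

/-! ### Operators defined on a spanning family -/

section Spanning

variable {E H F : Type*} [AddCommGroup E] [Module ℂ E]
  [NormedAddCommGroup H] [InnerProductSpace ℂ H]
  [NormedAddCommGroup F] [NormedSpace ℂ F]

theorem exists_closure_range_add_orthogonal [CompleteSpace H] (a : E →ₗ[ℂ] H) (f : H) :
    ∃ f₁ f₂ : H, f₁ ∈ closure (Set.range a) ∧ (∀ x, inner ℂ (a x) f₂ = 0) ∧ f = f₁ + f₂ := by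
  set K := (LinearMap.range a).topologicalClosure with hK
  have : CompleteSpace K := (Submodule.isClosed_topologicalClosure _).completeSpace_coe
  refine ⟨K.starProjection f, f - K.starProjection f, ?_, fun x => ?_, by abel⟩
  · have h := K.starProjection_apply_mem f
    have h' : K.starProjection f ∈ ((LinearMap.range a).topologicalClosure : Set H) := h
    rwa [Submodule.topologicalClosure_coe, LinearMap.coe_range] at h'
  · exact K.sub_starProjection_mem_orthogonal f _
      (Submodule.le_topologicalClosure _ (LinearMap.mem_range_self a x))

/-- A linear map dominated in norm by `a` factors through a bounded operator which vanishes on the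
orthogonal complement of the range of `a`. -/
theorem exists_clm_of_norm_le [CompleteSpace H] [CompleteSpace F] (a : E →ₗ[ℂ] H) (b : E →ₗ[ℂ] F) {C : ℝ}
    (h : ∀ x, ‖b x‖ ≤ C * ‖a x‖) (hC : 0 ≤ C) :
    ∃ T : H →L[ℂ] F, (∀ x, T (a x) = b x) ∧ (∀ f, ‖T f‖ ≤ C * ‖f‖) ∧
      ∀ f, (∀ x, inner ℂ (a x) f = 0) → T f = 0 := by
  set K := (LinearMap.range a).topologicalClosure with hK
  have hKc : CompleteSpace K := (Submodule.isClosed_topologicalClosure _).completeSpace_coe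
  have hmem : ∀ x, a x ∈ K := fun x =>
    Submodule.le_topologicalClosure _ (LinearMap.mem_range_self a x)
  let e : E →ₗ[ℂ] K := a.codRestrict K hmem
  have hd : DenseRange e := by
    rintro ⟨y, hy⟩
    rw [closure_subtype]
    have h1 : y ∈ closure (LinearMap.range a : Set H) := by
      rw [← Submodule.topologicalClosure_coe]; exact hy
    refine closure_mono ?_ h1
    rintro _ ⟨x, rfl⟩
    exact ⟨e x, ⟨x, rfl⟩, rfl⟩
  have hn : ∀ x, ‖b x‖ ≤ C * ‖e x‖ := h
  refine ⟨(b.extendOfNorm e).comp K.orthogonalProjectionOnto, fun x => ?_, fun f => ?_, fun f hf => ?_⟩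
  · have : K.orthogonalProjectionOnto (a x) = e x :=
      Submodule.orthogonalProjectionOnto_mem_subspace_eq_self (e x)
    rw [ContinuousLinearMap.comp_apply, this]
    exact LinearMap.extendOfNorm_eq hd ⟨C, hn⟩ x
  · refine (LinearMap.norm_extendOfNorm_apply_le hd C hn _).trans ?_
    gcongr
    exact K.norm_orthogonalProjectionOnto_apply_le f
  · have hf' : f ∈ Kᗮ := by
      rw [hK, Submodule.orthogonal_closure]
      rintro _ ⟨x, rfl⟩
      exact hf x
    rw [ContinuousLinearMap.comp_apply,
      Submodule.orthogonalProjectionOnto_apply_of_mem_orthogonal hf', map_zero]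

/-- A uniformly bounded family of operators that converges strongly on a dense set converges
strongly. -/
theorem tendsto_apply_of_mem_closure {ι : Type*} {l : Filter ι} {T : ι → H →L[ℂ] F}
    {T₀ : H →L[ℂ] F} {C : ℝ} (hC : 0 ≤ C) (hT : ∀ᶠ i in l, ∀ f, ‖T i f‖ ≤ C * ‖f‖)
    (hT₀ : ∀ f, ‖T₀ f‖ ≤ C * ‖f‖) {s : Set H}
    (hs : ∀ f ∈ s, Tendsto (fun i => T i f) l (𝓝 (T₀ f))) {f : H} (hf : f ∈ closure s) :
    Tendsto (fun i => T i f) l (𝓝 (T₀ f)) := by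
  rw [Metric.tendsto_nhds]
  intro η hη
  obtain ⟨g, hg, hfg⟩ := Metric.mem_closure_iff.1 hf (η / (3 * (C + 1))) (by positivity)
  rw [dist_eq_norm, lt_div_iff₀ (by positivity)] at hfg
  have hCfg : C * ‖f - g‖ < η / 3 := by nlinarith [norm_nonneg (f - g)]
  filter_upwards [hT, Metric.tendsto_nhds.1 (hs g hg) (η / 3) (by positivity)] with i hi hgi
  rw [dist_eq_norm] at hgi ⊢
  have h1 : T i f - T₀ f = T i (f - g) + (T i g - T₀ g) - T₀ (f - g) := by
    simp only [map_sub]; abel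
  rw [h1]
  linarith [norm_sub_le (T i (f - g) + (T i g - T₀ g)) (T₀ (f - g)),
    norm_add_le (T i (f - g)) (T i g - T₀ g), hi (f - g), hT₀ (f - g)]

end Spanning

/-! ### Families of vectors with Gram matrices on a semigroup -/

section GramFamily

/-- If `u s ^ 2 ≤ u 0 * u (2 s)` and `u` is bounded, then `u` is maximal at `0`: otherwise
`u (2 ^ n s) / u 0 ≥ (u s / u 0) ^ (2 ^ n)` would be unbounded. -/
theorem le_apply_zero_of_sq_le {u : ℝ → ℝ} {M : ℝ} (hu : ∀ s, 0 ≤ s → 0 ≤ u s)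
    (hM : ∀ s, 0 ≤ s → u s ≤ M) (h : ∀ s, 0 ≤ s → u s ^ 2 ≤ u 0 * u (2 * s)) {s : ℝ}
    (hs : 0 ≤ s) : u s ≤ u 0 := by
  rcases (hu 0 le_rfl).eq_or_lt with h0 | h0
  · have := h s hs
    rw [← h0, zero_mul] at this
    rw [← h0]
    exact (pow_eq_zero_iff two_ne_zero).1 (le_antisymm this (sq_nonneg _)) |>.le
  by_contra! hlt
  set r := u s / u 0 with hr
  have hr1 : 1 < r := (one_lt_div h0).2 hlt
  have key : ∀ n : ℕ, r ^ (2 ^ n) ≤ u (2 ^ n * s) / u 0 := by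
    intro n
    induction n with
    | zero => simp [hr]
    | succ n ih =>
      have h1 := h (2 ^ n * s) (by positivity)
      have h2 : (u (2 ^ n * s) / u 0) ^ 2 ≤ u (2 * (2 ^ n * s)) / u 0 := by
        rw [div_pow, div_le_div_iff₀ (by positivity) h0]
        nlinarith
      calc r ^ 2 ^ (n + 1) = (r ^ 2 ^ n) ^ 2 := by rw [← pow_mul, pow_succ]
        _ ≤ (u (2 ^ n * s) / u 0) ^ 2 := by gcongr
        _ ≤ _ := h2
        _ = _ := by rw [pow_succ]; ring_nf
  obtain ⟨n, hn⟩ := pow_unbounded_of_one_lt (M / u 0) hr1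
  have h3 : r ^ n ≤ r ^ (2 ^ n) := pow_le_pow_right₀ hr1.le Nat.lt_two_pow_self.le
  have h4 : u (2 ^ n * s) / u 0 ≤ M / u 0 := by
    have := hM (2 ^ n * s) (by positivity)
    gcongr
  linarith [key n]

variable {H X : Type*} [NormedAddCommGroup H] [InnerProductSpace ℂ H]

theorem norm_inner_self_eq_sq (x : H) : ‖inner ℂ x x‖ = ‖x‖ ^ 2 := by
  rw [inner_self_eq_norm_sq_to_K]
  simp

/-- The synthesis map `x ↦ ∑ xⱼ κ (s + δⱼ) pⱼ` of a family `κ` of vectors, over finitely supported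
coefficients indexed by pairs `j = (δⱼ, pⱼ)` with `δⱼ > 0`. -/
noncomputable def synthesis (κ : ℝ → X → H) (s : ℝ) : (Set.Ioi (0 : ℝ) × X →₀ ℂ) →ₗ[ℂ] H :=
  Finsupp.linearCombination ℂ fun j => κ (s + j.1) j.2

theorem inner_synthesis {κ : ℝ → X → H} {g : ℝ → X → X → ℂ}
    (hκ : ∀ ε δ, 0 < ε → 0 < δ → ∀ p q, inner ℂ (κ ε p) (κ δ q) = g (ε + δ) p q)
    {s t : ℝ} (hs : 0 ≤ s) (ht : 0 ≤ t) (x y : Set.Ioi (0 : ℝ) × X →₀ ℂ) :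
    inner ℂ (synthesis κ s x) (synthesis κ t y) =
      x.sum fun i v => y.sum fun j w => star v * w * g (s + t + (i.1 + j.1)) i.2 j.2 := by
  simp only [synthesis, Finsupp.linearCombination_apply]
  rw [Finsupp.sum_inner]
  simp only [Finsupp.inner_sum]
  simp only [Finsupp.sum]
  refine Finset.sum_congr rfl fun i _ => Finset.sum_congr rfl fun j _ => ?_
  have hi : (0 : ℝ) < i.1 := i.1.2
  have hj : (0 : ℝ) < j.1 := j.1.2
  rw [inner_smul_left, inner_smul_right, hκ _ _ (by positivity) (by positivity), starRingEnd_apply,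
    show s + (i.1 : ℝ) + (t + j.1) = s + t + (i.1 + j.1) by ring]
  ring

theorem norm_synthesis_le {κ : ℝ → X → H} {g : ℝ → X → X → ℂ}
    (hκ : ∀ ε δ, 0 < ε → 0 < δ → ∀ p q, inner ℂ (κ ε p) (κ δ q) = g (ε + δ) p q)
    (hg : ∀ a b p, 0 < a → a ≤ b → ‖g b p p‖ ≤ ‖g a p p‖)
    {s : ℝ} (hs : 0 ≤ s) (x : Set.Ioi (0 : ℝ) × X →₀ ℂ) :
    ‖synthesis κ s x‖ ≤ ‖synthesis κ 0 x‖ := by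
  refine le_apply_zero_of_sq_le (u := fun s => ‖synthesis κ s x‖)
    (M := x.sum fun i v => ‖v‖ * ‖κ i.1 i.2‖) (fun _ _ => norm_nonneg _) (fun s hs => ?_)
    (fun s hs => ?_) hs
  · simp only [synthesis, Finsupp.linearCombination_apply]
    refine (norm_sum_le _ _).trans (Finset.sum_le_sum fun i _ => ?_)
    have hi : (0 : ℝ) < i.1 := i.1.2
    rw [norm_smul]
    refine mul_le_mul_of_nonneg_left ?_ (norm_nonneg _)
    rw [← sq_le_sq₀ (norm_nonneg _) (norm_nonneg _), ← norm_inner_self_eq_sq,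
      ← norm_inner_self_eq_sq, hκ _ _ (by positivity) (by positivity), hκ _ _ hi hi]
    exact hg _ _ _ (by positivity) (by linarith)
  · have h1 : inner ℂ (synthesis κ s x) (synthesis κ s x) =
        inner ℂ (synthesis κ 0 x) (synthesis κ (2 * s) x) := by
      rw [inner_synthesis hκ hs hs, inner_synthesis hκ le_rfl (by positivity)]
      simp only [two_mul, zero_add]
    rw [← norm_inner_self_eq_sq, h1]
    exact norm_inner_le_norm _ _

/-- A family with Gram matrix `g (ε + δ)` is continuous from the right in its parameter. -/
theorem tendsto_shift_of_gram {γ : ℝ → X → H} {g : ℝ → X → X → ℂ} {c : ℝ}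
    (hγ : ∀ ε δ, 0 < ε → 0 < δ → ∀ p q, inner ℂ (γ ε p) (γ δ q) = c ^ 2 * g (ε + δ) p q)
    (hgc : ∀ a p, 0 < a → ContinuousAt (fun t => g t p p) a) {d : ℝ} (hd : 0 < d) (q : X) :
    Tendsto (fun ε => γ (ε + d) q) (𝓝[>] 0) (𝓝 (γ d q)) := by
  rw [tendsto_iff_norm_sub_tendsto_zero]
  have h0 := hgc (d + d) q (by positivity)
  have t1 : Tendsto (fun ε : ℝ => ε + d + (ε + d)) (𝓝[>] 0) (𝓝 (d + d)) := by
    have : Continuous fun ε : ℝ => ε + d + (ε + d) := by fun_prop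
    simpa using (this.tendsto 0).mono_left nhdsWithin_le_nhds
  have t2 : Tendsto (fun ε : ℝ => ε + d + d) (𝓝[>] 0) (𝓝 (d + d)) := by
    have : Continuous fun ε : ℝ => ε + d + d := by fun_prop
    simpa using (this.tendsto 0).mono_left nhdsWithin_le_nhds
  have hG := ((((h0.tendsto.comp t1).sub ((h0.tendsto.comp t2).const_mul 2)).add_const
    (g (d + d) q q)).const_mul ((c : ℂ) ^ 2)).norm
  have hval : ‖(c : ℂ) ^ 2 * (g (d + d) q q - 2 * g (d + d) q q + g (d + d) q q)‖ = 0 := by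
    rw [norm_eq_zero]; ring
  rw [hval] at hG
  have hsq : Tendsto (fun ε => ‖γ (ε + d) q - γ d q‖ ^ 2) (𝓝[>] 0) (𝓝 0) := by
    refine hG.congr' ?_
    filter_upwards [self_mem_nhdsWithin] with ε hε
    have hε' : (0 : ℝ) < ε + d := add_pos hε hd
    rw [← norm_inner_self_eq_sq, inner_sub_left, inner_sub_right, inner_sub_right,
      hγ _ _ hε' hε', hγ _ _ hε' hd, hγ _ _ hd hε', hγ _ _ hd hd, add_comm d (ε + d)]
    congr 1
    simp only [Function.comp_apply]
    ring
  have := hsq.sqrt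
  simpa [Real.sqrt_sq (norm_nonneg _)] using this

variable [CompleteSpace H] [MeasurableSpace X] {μ : Measure X}

/-- Boundary values of reproducing kernels. The vectors `κ ε p` represent point evaluation on the
shell of height `ε`, so that `p ↦ ⟪κ ε p, f⟫` is the restriction to that shell of the function
defined by `f`. If their Gram matrix depends on the sum of the heights only, and the functions
`γ a q = g a · q` have the same Gram matrix up to the factor `c ^ 2`, then these restrictions
converge in `L²`; the limit operator sends `κ δ q` to `γ δ q` and vanishes on the orthogonal
complement of all `κ δ q`, hence has norm `c`. -/
theorem exists_boundary_operator [Nonempty X] {κ : ℝ → X → H} {γ : ℝ → X → Lp ℂ 2 μ}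
    {g : ℝ → X → X → ℂ} {c : ℝ} (hc : 0 ≤ c)
    (hκ : ∀ ε δ, 0 < ε → 0 < δ → ∀ p q, inner ℂ (κ ε p) (κ δ q) = g (ε + δ) p q)
    (hγ : ∀ ε δ, 0 < ε → 0 < δ → ∀ p q, inner ℂ (γ ε p) (γ δ q) = c ^ 2 * g (ε + δ) p q)
    (hγg : ∀ a q, 0 < a → γ a q =ᵐ[μ] fun p => g a p q)
    (hg : ∀ a b p, 0 < a → a ≤ b → ‖g b p p‖ ≤ ‖g a p p‖)
    (hg₀ : ∀ a p, 0 < a → g a p p ≠ 0)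
    (hgc : ∀ a p, 0 < a → ContinuousAt (fun t => g t p p) a) :
    ∃ L : H →L[ℂ] Lp ℂ 2 μ, ‖L‖ = c ∧ ∀ f : H,
      (∀ ε, 0 < ε → MemLp (fun p => inner ℂ (κ ε p) f) 2 μ) ∧
      Tendsto (fun ε : ℝ => eLpNorm ((fun p => inner ℂ (κ ε p) f) - (L f : X → ℂ)) 2 μ) (𝓝[>] 0) (𝓝 0) := by
  have hγκ : ∀ s, 0 ≤ s → ∀ x, ‖synthesis γ s x‖ = c * ‖synthesis κ s x‖ := by
    intro s hs x
    rw [← sq_eq_sq₀ (norm_nonneg _) (by positivity), mul_pow, ← norm_inner_self_eq_sq,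
      ← norm_inner_self_eq_sq, inner_synthesis hκ hs hs,
      inner_synthesis (g := fun a p q => c ^ 2 * g a p q) hγ hs hs]
    have : ((c : ℂ) ^ 2) = ((c ^ 2 : ℝ) : ℂ) := by push_cast; rfl
    rw [← Complex.norm_of_nonneg (sq_nonneg c), ← norm_mul, ← this]
    congr 1
    simp only [Finsupp.sum, Finset.mul_sum]
    exact Finset.sum_congr rfl fun i _ => Finset.sum_congr rfl fun j _ => by ring
  have hbd : ∀ s, 0 ≤ s → ∀ x, ‖synthesis γ s x‖ ≤ c * ‖synthesis κ 0 x‖ := fun s hs x => by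
    rw [hγκ s hs]
    gcongr
    exact norm_synthesis_le hκ hg hs x
  have hex : ∀ s : ℝ, ∃ T : H →L[ℂ] Lp ℂ 2 μ, 0 ≤ s →
      (∀ x, T (synthesis κ 0 x) = synthesis γ s x) ∧ (∀ f, ‖T f‖ ≤ c * ‖f‖) ∧
      ∀ f, (∀ x, inner ℂ (synthesis κ 0 x) f = 0) → T f = 0 := by
    intro s
    by_cases hs : 0 ≤ s
    · obtain ⟨T, hT⟩ := exists_clm_of_norm_le (synthesis κ 0) (synthesis γ s) (hbd s hs) hc
      exact ⟨T, fun _ => hT⟩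
    · exact ⟨0, fun h => absurd h hs⟩
  choose T hT using hex
  have hsingle : ∀ s q, (0 : ℝ) < s → ∃ x, synthesis κ 0 x = κ s q ∧
      ∀ ε, 0 ≤ ε → T ε (κ s q) = γ (ε + s) q := by
    intro s q hs
    refine ⟨Finsupp.single (⟨s, hs⟩, q) 1, by simp [synthesis], fun ε hε => ?_⟩
    have := (hT ε hε).1 (Finsupp.single (⟨s, hs⟩, q) 1)
    simpa [synthesis] using this
  -- The shell function of `f` is a representative of `T ε f`.
  have hrep : ∀ ε, 0 < ε → ∀ f, (T ε f : X → ℂ) =ᵐ[μ] fun p => inner ℂ (κ ε p) f := by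
    intro ε hε f
    have hspan : ∀ x, (T ε (synthesis κ 0 x) : X → ℂ) =ᵐ[μ]
        fun p => inner ℂ (κ ε p) (synthesis κ 0 x) := by
      intro x
      induction x using Finsupp.induction_linear with
      | zero =>
        simp only [map_zero, inner_zero_right]
        exact Lp.coeFn_zero ℂ 2 μ
      | add x y hx hy =>
        simp only [map_add, inner_add_right]
        filter_upwards [Lp.coeFn_add (T ε (synthesis κ 0 x)) (T ε (synthesis κ 0 y)), hx, hy]
          with p h h1 h2
        rw [h, Pi.add_apply, h1, h2]
      | single j v =>
        obtain ⟨x, -, hx⟩ := hsingle j.1 j.2 j.1.2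
        have hj : synthesis κ 0 (Finsupp.single j v) = v • κ j.1 j.2 := by simp [synthesis]
        have hj0 : (0 : ℝ) < j.1 := j.1.2
        rw [hj, map_smul, hx ε hε.le]
        filter_upwards [Lp.coeFn_smul v (γ (ε + j.1) j.2), hγg (ε + j.1) j.2 (add_pos hε hj0)]
          with p h h1
        rw [h, Pi.smul_apply, h1, inner_smul_right, hκ _ _ hε hj0, smul_eq_mul]
    obtain ⟨f₁, f₂, h₁, h₂, rfl⟩ := exists_closure_range_add_orthogonal (synthesis κ 0) f
    have hzero : ∀ p, inner ℂ (κ ε p) f₂ = 0 := by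
      intro p
      obtain ⟨x, hx, -⟩ := hsingle ε p hε
      rw [← hx]
      exact h₂ x
    simp only [map_add, inner_add_right, hzero, (hT ε hε.le).2.2 f₂ h₂, add_zero]
    obtain ⟨u, hu, hlim⟩ := mem_closure_iff_seq_limit.1 h₁
    have hTlim : Tendsto (fun n => T ε (u n)) atTop (𝓝 (T ε f₁)) :=
      ((T ε).continuous.tendsto f₁).comp hlim
    obtain ⟨φ, hφ, hae⟩ := (tendstoInMeasure_of_tendsto_Lp hTlim).exists_seq_tendsto_ae
    have hall : ∀ᵐ p ∂μ, ∀ n, (T ε (u n) : X → ℂ) p = inner ℂ (κ ε p) (u n) := by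
      rw [ae_all_iff]
      intro n
      obtain ⟨x, hx⟩ := hu n
      rw [← hx]
      exact hspan x
    filter_upwards [hae, hall] with p hp hp'
    refine tendsto_nhds_unique hp ?_
    simp only [hp']
    exact (Tendsto.inner tendsto_const_nhds hlim).comp hφ.tendsto_atTop
  have hspanlim : ∀ x, Tendsto (fun ε => T ε (synthesis κ 0 x)) (𝓝[>] 0)
      (𝓝 (T 0 (synthesis κ 0 x))) := by
    intro x
    induction x using Finsupp.induction_linear with
    | zero => simp
    | add x y hx hy =>
      simp only [map_add]
      exact hx.add hy
    | single j v =>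
      obtain ⟨x, -, hx⟩ := hsingle j.1 j.2 j.1.2
      have hj : synthesis κ 0 (Finsupp.single j v) = v • κ j.1 j.2 := by simp [synthesis]
      have hj0 : (0 : ℝ) < j.1 := j.1.2
      simp only [hj, map_smul]
      refine Tendsto.const_smul ?_ v
      rw [hx 0 le_rfl, zero_add]
      have heq : ∀ᶠ ε in 𝓝[>] (0 : ℝ), γ (ε + j.1) j.2 = T ε (κ j.1 j.2) := by
        filter_upwards [self_mem_nhdsWithin] with ε hε
        rw [hx ε (le_of_lt hε)]
      refine Tendsto.congr' heq ?_
      exact tendsto_shift_of_gram hγ hgc hj0 j.2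
  have hlim : ∀ f, Tendsto (fun ε => T ε f) (𝓝[>] 0) (𝓝 (T 0 f)) := by
    intro f
    obtain ⟨f₁, f₂, h₁, h₂, rfl⟩ := exists_closure_range_add_orthogonal (synthesis κ 0) f
    have hf₁ : Tendsto (fun ε => T ε f₁) (𝓝[>] 0) (𝓝 (T 0 f₁)) := by
      refine tendsto_apply_of_mem_closure hc ?_ (hT 0 le_rfl).2.1 ?_ h₁
      · filter_upwards [self_mem_nhdsWithin] with ε hε
        exact (hT ε (le_of_lt hε)).2.1
      · rintro _ ⟨x, rfl⟩
        exact hspanlim x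
    have hf₂ : Tendsto (fun ε => T ε f₂) (𝓝[>] 0) (𝓝 (T 0 f₂)) := by
      rw [(hT 0 le_rfl).2.2 f₂ h₂]
      refine tendsto_const_nhds.congr' ?_
      filter_upwards [self_mem_nhdsWithin] with ε hε
      rw [(hT ε (le_of_lt hε)).2.2 f₂ h₂]
    simpa using hf₁.add hf₂
  refine ⟨T 0, le_antisymm ((T 0).opNorm_le_bound hc (hT 0 le_rfl).2.1) ?_, fun f =>
    ⟨fun ε hε => (Lp.memLp (T ε f)).ae_eq (hrep ε hε f), ?_⟩⟩
  · -- The bound `c` is attained at every `κ 1 q`.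
    obtain ⟨q⟩ := ‹Nonempty X›
    obtain ⟨x, hx, hx'⟩ := hsingle 1 q one_pos
    have hne : κ 1 q ≠ 0 := by
      intro h0
      have := hκ 1 1 one_pos one_pos q q
      rw [h0, inner_zero_left] at this
      exact hg₀ _ q (by norm_num) this.symm
    have h1 : ‖T 0 (κ 1 q)‖ = c * ‖κ 1 q‖ := by
      rw [← hx, (hT 0 le_rfl).1, hγκ 0 le_rfl]
    have h2 := (T 0).le_opNorm (κ 1 q)
    rw [h1] at h2
    exact le_of_mul_le_mul_right h2 (norm_pos_iff.2 hne)
  · have h1 : Tendsto (fun ε => eLpNorm ((T ε f : X → ℂ) - (T 0 f : X → ℂ)) 2 μ) (𝓝[>] 0) (𝓝 0) :=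
      (Lp.tendsto_Lp_iff_tendsto_eLpNorm' _ _).1 (hlim f)
    refine h1.congr' ?_
    filter_upwards [self_mem_nhdsWithin] with ε hε
    refine eLpNorm_congr_ae ?_
    filter_upwards [hrep ε hε f] with p hp
    simp only [Pi.sub_apply, hp]

end GramFamily

/-! ### One-dimensional integrals -/

section Integrals

open Complex Set

theorem integrable_inv_add_mul_sq {r l : ℝ} (hr : 0 < r) (hl : 0 < l) (m : ℝ) :
    Integrable fun x : ℝ => (r + l * (x + m) ^ 2)⁻¹ := by
  have h := ((integrable_inv_one_add_sq.comp_mul_left' (R := √(l / r)) (by positivity)).comp_add_right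
    m).const_mul r⁻¹
  refine h.congr (Eventually.of_forall fun x => ?_)
  simp only
  rw [mul_pow, Real.sq_sqrt (by positivity), ← mul_inv]
  congr 1
  field_simp

theorem tendsto_log_add_mul_I_sub_log (a b : ℂ) (ha : 0 < a.re) (hb : 0 < b.re) :
    Tendsto (fun t : ℝ => log (a + t * I) - log (b - t * I)) atTop (𝓝 (Real.pi * I)) := by
  have hinv : Tendsto (fun t : ℝ => ((t⁻¹ : ℝ) : ℂ)) atTop (𝓝 0) := by
    have := (Complex.continuous_ofReal.tendsto 0).comp (tendsto_inv_atTop_zero (𝕜 := ℝ))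
    rwa [ofReal_zero] at this
  have h1 : Tendsto (fun t : ℝ => log (a * (t⁻¹ : ℝ) + I)) atTop (𝓝 (log I)) := by
    refine (continuousAt_clog (by simp [slitPlane])).tendsto.comp ?_
    simpa using (hinv.const_mul a).add_const I
  have h2 : Tendsto (fun t : ℝ => log (b * (t⁻¹ : ℝ) - I)) atTop (𝓝 (log (-I))) := by
    refine (continuousAt_clog (by simp [slitPlane])).tendsto.comp ?_
    simpa using (hinv.const_mul b).sub_const I
  have h3 : log I - log (-I) = Real.pi * I := by
    rw [log_I, log_neg_I]; ring
  rw [← h3]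
  refine (h1.sub h2).congr' ?_
  filter_upwards [eventually_gt_atTop 0] with t ht
  have hat : a + t * I ≠ 0 := ne_zero_of_re_pos (by simpa using ha)
  have hbt : b - t * I ≠ 0 := ne_zero_of_re_pos (by simpa using hb)
  have htc : (t : ℂ) ≠ 0 := by exact_mod_cast ht.ne'
  have e1 : a * (t⁻¹ : ℝ) + I = ((t⁻¹ : ℝ) : ℂ) * (a + t * I) := by
    push_cast; field_simp
  have e2 : b * (t⁻¹ : ℝ) - I = ((t⁻¹ : ℝ) : ℂ) * (b - t * I) := by
    push_cast; field_simp
  rw [e1, e2, log_ofReal_mul (inv_pos.2 ht) hat, log_ofReal_mul (inv_pos.2 ht) hbt]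
  ring

theorem norm_add_mul_I_sq (a : ℂ) (t : ℝ) : ‖a + t * I‖ ^ 2 = a.re ^ 2 + (t + a.im) ^ 2 := by
  rw [← normSq_eq_norm_sq, normSq_apply]
  simp
  ring

/-- The `L²(ℝ)` pairing of two inverse squares. -/
theorem integral_inv_sq_mul_inv_sq {a b : ℂ} (ha : 0 < a.re) (hb : 0 < b.re) :
    ∫ t : ℝ, ((a + t * I) ^ 2)⁻¹ * ((b - t * I) ^ 2)⁻¹ = 4 * Real.pi * ((a + b) ^ 3)⁻¹ := by
  have hab : a + b ≠ 0 := ne_zero_of_re_pos (by simpa using add_pos ha hb)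
  have hat : ∀ t : ℝ, a + t * I ≠ 0 := fun t => ne_zero_of_re_pos (by simpa using ha)
  have hbt : ∀ t : ℝ, b - t * I ≠ 0 := fun t => ne_zero_of_re_pos (by simpa using hb)
  have hta : Tendsto (fun t : ℝ => (a + t * I)⁻¹) (cocompact ℝ) (𝓝 0) := by
    refine tendsto_inv₀_cobounded.comp ?_
    rw [← tendsto_norm_atTop_iff_cobounded]
    refine tendsto_atTop_mono (fun t => ?_)
      (tendsto_atTop_add_const_right _ (-‖a‖) (tendsto_norm_cocompact_atTop (E := ℝ)))
    have := norm_sub_norm_le (t * I : ℂ) (-a)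
    simp only [norm_mul, norm_I, mul_one, norm_real, norm_neg, sub_neg_eq_add] at this
    rw [add_comm a]
    linarith
  have htb : Tendsto (fun t : ℝ => (b - t * I)⁻¹) (cocompact ℝ) (𝓝 0) := by
    refine tendsto_inv₀_cobounded.comp ?_
    rw [← tendsto_norm_atTop_iff_cobounded]
    refine tendsto_atTop_mono (fun t => ?_)
      (tendsto_atTop_add_const_right _ (-‖b‖) (tendsto_norm_cocompact_atTop (E := ℝ)))
    have := norm_sub_norm_le (t * I : ℂ) b
    simp only [norm_mul, norm_I, mul_one, norm_real] at this
    rw [norm_sub_rev]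
    linarith
  -- Partial fractions: `((a + it)(b - it))⁻¹ = (a + b)⁻¹ ((a + it)⁻¹ + (b - it)⁻¹)`, squared.
  set F : ℝ → ℂ := fun t => ((a + b) ^ 2)⁻¹ * (I * (a + t * I)⁻¹ - I * (b - t * I)⁻¹) +
    2 * ((a + b) ^ 3)⁻¹ * (-I * (log (a + t * I) - log (b - t * I))) with hF
  have hderiv : ∀ t : ℝ, HasDerivAt F (((a + t * I) ^ 2)⁻¹ * ((b - t * I) ^ 2)⁻¹) t := by
    intro t
    have d1 : HasDerivAt (fun t : ℝ => a + t * I) I t := by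
      simpa using ((hasDerivAt_id t).ofReal_comp.mul_const I).const_add a
    have d2 : HasDerivAt (fun t : ℝ => b - t * I) (-I) t := by
      simpa using ((hasDerivAt_id t).ofReal_comp.mul_const I).const_sub b
    have l1 : HasDerivAt (fun t : ℝ => log (a + t * I)) (I / (a + t * I)) t :=
      d1.clog_real (Or.inl (by simpa using ha))
    have l2 : HasDerivAt (fun t : ℝ => log (b - t * I)) (-I / (b - t * I)) t :=
      d2.clog_real (Or.inl (by simpa using hb))
    have := ((((d1.fun_inv (hat t)).const_mul I).sub ((d2.fun_inv (hbt t)).const_mul I)).const_mul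
      ((a + b) ^ 2)⁻¹).add (((l1.sub l2).const_mul (-I)).const_mul (2 * ((a + b) ^ 3)⁻¹))
    refine this.congr_deriv ?_
    have hA := hat t
    have hB := hbt t
    obtain ⟨A, hAe⟩ : ∃ A, A = a + t * I := ⟨_, rfl⟩
    obtain ⟨B, hBe⟩ : ∃ B, B = b - t * I := ⟨_, rfl⟩
    have hs : a + b = A + B := by rw [hAe, hBe]; ring
    rw [← hAe] at hA
    rw [← hBe] at hB
    rw [hs] at hab
    rw [hs, ← hAe, ← hBe]
    field_simp
    linear_combination (-(A + B) ^ 3) * I_sq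
  have hint : Integrable fun t : ℝ => ((a + t * I) ^ 2)⁻¹ * ((b - t * I) ^ 2)⁻¹ := by
    have h := (integrable_inv_add_mul_sq (r := a.re ^ 2) (l := 1) (by positivity) one_pos
      a.im).mul_const (b.re ^ 2)⁻¹
    refine h.mono' ?_ (Eventually.of_forall fun t => ?_)
    · refine Continuous.aestronglyMeasurable ?_
      exact ((by fun_prop : Continuous fun t : ℝ => (a + t * I) ^ 2).inv₀
        fun t => pow_ne_zero 2 (hat t)).mul
        ((by fun_prop : Continuous fun t : ℝ => (b - t * I) ^ 2).inv₀
        fun t => pow_ne_zero 2 (hbt t))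
    · have hb' : b.re ^ 2 ≤ ‖b - t * I‖ ^ 2 := by
        have := norm_add_mul_I_sq b (-t)
        rw [ofReal_neg, neg_mul, ← sub_eq_add_neg] at this
        rw [this]
        nlinarith [sq_nonneg (-t + b.im)]
      rw [norm_mul, norm_inv, norm_inv, norm_pow, norm_pow, norm_add_mul_I_sq, one_mul]
      gcongr
  have hrat : Tendsto (fun t : ℝ => ((a + b) ^ 2)⁻¹ * (I * (a + t * I)⁻¹ - I * (b - t * I)⁻¹))
      (cocompact ℝ) (𝓝 0) := by
    simpa using ((hta.const_mul I).sub (htb.const_mul I)).const_mul ((a + b) ^ 2)⁻¹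
  rw [integral_of_hasDerivAt_of_tendsto hderiv hint
    (m := 0 + 2 * ((a + b) ^ 3)⁻¹ * (-I * (-(Real.pi * I))))
    (n := 0 + 2 * ((a + b) ^ 3)⁻¹ * (-I * (Real.pi * I)))]
  · linear_combination (-4 * Real.pi * ((a + b) ^ 3)⁻¹) * I_sq
  · refine (hrat.mono_left atBot_le_cocompact).add (Tendsto.const_mul _ (Tendsto.const_mul _ ?_))
    refine ((tendsto_log_add_mul_I_sub_log b a hb ha).comp tendsto_neg_atBot_atTop).neg.congr
      fun t => ?_
    simp only [Function.comp_apply, ofReal_neg, neg_mul, sub_neg_eq_add, ← sub_eq_add_neg]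
    ring
  · exact (hrat.mono_left atTop_le_cocompact).add
      (Tendsto.const_mul _ ((tendsto_log_add_mul_I_sub_log a b ha hb).const_mul _))

theorem integrableOn_pow_mul_cexp {Q : ℂ} (hQ : 0 < Q.re) (n : ℕ) :
    IntegrableOn (fun ξ : ℝ => (ξ : ℂ) ^ n * cexp (-(ξ * Q))) (Ioi 0) := by
  have h := integrableOn_rpow_mul_exp_neg_mul_rpow (s := n) (p := 1) (b := Q.re)
    (by have : (0 : ℝ) ≤ n := n.cast_nonneg
        linarith) one_pos hQ
  refine Integrable.mono' h (by fun_prop) ?_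
  filter_upwards [self_mem_ae_restrict measurableSet_Ioi] with ξ hξ
  have hξ : 0 < ξ := hξ
  rw [norm_mul, norm_pow, norm_real, Real.norm_of_nonneg hξ.le, norm_exp, Real.rpow_natCast,
    Real.rpow_one]
  simp [mul_comm]

theorem integral_pow_mul_cexp {Q : ℂ} (hQ : 0 < Q.re) (n : ℕ) :
    ∫ ξ : ℝ in Ioi 0, (ξ : ℂ) ^ n * cexp (-(ξ * Q)) = n.factorial * (Q ^ (n + 1))⁻¹ := by
  have hQ0 := ne_zero_of_re_pos hQ
  have hlim : ∀ n : ℕ, Tendsto (fun ξ : ℝ => (ξ : ℂ) ^ n * cexp (-(ξ * Q))) atTop (𝓝 0) := by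
    intro n
    rw [tendsto_zero_iff_norm_tendsto_zero]
    have := (isLittleO_pow_exp_pos_mul_atTop n hQ).tendsto_div_nhds_zero
    refine this.congr' ?_
    filter_upwards [eventually_gt_atTop 0] with ξ hξ
    rw [norm_mul, norm_pow, norm_real, Real.norm_of_nonneg hξ.le, norm_exp, div_eq_mul_inv,
      ← Real.exp_neg]
    simp [mul_comm]
  have hexp : ∀ ξ : ℝ, HasDerivAt (fun ξ : ℝ => cexp (-(ξ * Q))) (cexp (-(ξ * Q)) * (-Q)) ξ := by
    intro ξ
    have : HasDerivAt (fun ξ : ℝ => -((ξ : ℂ) * Q)) (-Q) ξ := by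
      simpa using ((hasDerivAt_id ξ).ofReal_comp.mul_const Q).fun_neg
    exact this.cexp
  induction n with
  | zero =>
    have h := integral_Ioi_of_hasDerivAt_of_tendsto' (a := 0) (m := 0) (fun ξ _ => hexp ξ)
      (by simpa [IntegrableOn] using (integrableOn_pow_mul_cexp hQ 0).mul_const (-Q)) (by simpa using hlim 0)
    rw [integral_mul_const] at h
    simp only [pow_zero, one_mul, Nat.factorial_zero, Nat.cast_one, zero_add, pow_one]
    rw [← mul_right_inj' (neg_ne_zero.2 hQ0), mul_comm, h]
    simp [hQ0]
  | succ n ih =>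
    have hd : ∀ ξ ∈ Ici (0 : ℝ), HasDerivAt (fun ξ : ℝ => (ξ : ℂ) ^ (n + 1) * cexp (-(ξ * Q)))
        ((n + 1) * ((ξ : ℂ) ^ n * cexp (-(ξ * Q))) - Q * ((ξ : ℂ) ^ (n + 1) * cexp (-(ξ * Q)))) ξ := by
      intro ξ _
      have hp : HasDerivAt (fun ξ : ℝ => (ξ : ℂ) ^ (n + 1)) ((n + 1) * (ξ : ℂ) ^ n) ξ := by
        simpa using ((hasDerivAt_id ξ).ofReal_comp).fun_pow (n + 1)
      refine (hp.mul (hexp ξ)).congr_deriv ?_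
      ring
    have i1 := (integrableOn_pow_mul_cexp hQ n).const_mul ((n : ℂ) + 1)
    have i2 := (integrableOn_pow_mul_cexp hQ (n + 1)).const_mul Q
    have h := integral_Ioi_of_hasDerivAt_of_tendsto' hd (i1.sub i2) (hlim (n + 1))
    rw [integral_sub i1 i2, integral_const_mul, integral_const_mul, ih] at h
    simp only [ofReal_zero, ne_eq, Nat.add_eq_zero_iff, one_ne_zero, and_false, not_false_eq_true,
      zero_pow, zero_mul, sub_zero, sub_eq_zero] at h
    rw [← mul_right_inj' hQ0, ← h, Nat.factorial_succ]
    push_cast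
    field_simp
    ring

/-! ### The planar integral of an inverse cube -/

/-- Integral over the plane of the inverse cube of a complex quadratic polynomial whose real part
is bounded below by a positive constant. -/
theorem integral_inv_quadratic_cube {u v : ℝ} (hu : 0 < u) (hv : 0 < v) (b₁ b₂ C : ℂ)
    (hpos : 0 < C.re - b₁.re ^ 2 / (4 * u) - b₂.re ^ 2 / (4 * v)) :
    ∫ w : ℝ × ℝ, ((u * w.1 ^ 2 + v * w.2 ^ 2 + b₁ * w.1 + b₂ * w.2 + C : ℂ) ^ 3)⁻¹ =
      Real.pi / (2 * √(u * v)) * ((C - b₁ ^ 2 / (4 * u) - b₂ ^ 2 / (4 * v)) ^ 2)⁻¹ := by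
  set η := C.re - b₁.re ^ 2 / (4 * u) - b₂.re ^ 2 / (4 * v) with hη
  set Q : ℝ × ℝ → ℂ := fun w => u * w.1 ^ 2 + v * w.2 ^ 2 + b₁ * w.1 + b₂ * w.2 + C with hQ
  have hQre : ∀ w, (Q w).re = η + u * (w.1 + b₁.re / (2 * u)) ^ 2 +
      v * (w.2 + b₂.re / (2 * v)) ^ 2 := by
    intro w
    simp only [hQ, hη, add_re, mul_re, ofReal_re, ofReal_im, ← ofReal_pow, mul_zero,
      sub_zero]
    field_simp
    ring
  have hQpos : ∀ w, 0 < (Q w).re := fun w => by rw [hQre]; positivity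
  set C' := C - b₁ ^ 2 / (4 * u) - b₂ ^ 2 / (4 * v) with hC'
  have hC'pos : 0 < C'.re := by
    have e : ∀ (b : ℂ) (r : ℝ), (b ^ 2 / (4 * r)).re = (b.re ^ 2 - b.im ^ 2) / (4 * r) := by
      intro b r
      rw [show (4 * r : ℂ) = ((4 * r : ℝ) : ℂ) by push_cast; rfl, div_ofReal_re, sq, mul_re]
      ring
    rw [hC', sub_re, sub_re, e, e, sub_div, sub_div]
    have h1 : 0 ≤ b₁.im ^ 2 / (4 * u) := by positivity
    have h2 : 0 ≤ b₂.im ^ 2 / (4 * v) := by positivity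
    linarith
  have hcube : ∀ w, ((Q w) ^ 3)⁻¹ =
      2⁻¹ * ∫ ξ : ℝ in Ioi 0, (ξ : ℂ) ^ 2 * cexp (-(ξ * Q w)) := by
    intro w
    rw [integral_pow_mul_cexp (hQpos w)]
    simp
  -- The factor `ξ ^ 2` absorbs the two factors `ξ⁻¹` coming from `exp (-ξ s) ≤ (ξ s)⁻¹`, so that the
  -- integrand is dominated by a product of functions of one variable.
  have hdom : Integrable (Function.uncurry fun (w : ℝ × ℝ) (ξ : ℝ) =>
      (ξ : ℂ) ^ 2 * cexp (-(ξ * Q w))) (volume.prod (volume.restrict (Ioi 0))) := by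
    have hX := integrable_inv_add_mul_sq (r := η / 4) (by positivity) hu (b₁.re / (2 * u))
    have hY := integrable_inv_add_mul_sq (r := η / 4) (by positivity) hv (b₂.re / (2 * v))
    have hE : Integrable (fun ξ : ℝ => Real.exp (-(η / 2) * ξ)) (volume.restrict (Ioi 0)) :=
      exp_neg_integrableOn_Ioi 0 (by positivity)
    refine Integrable.mono' ((hX.mul_prod hY).mul_prod hE) ?_ ?_
    · refine Continuous.aestronglyMeasurable ?_
      simp only [hQ, Function.uncurry_def]
      fun_prop
    · have hξ : ∀ᵐ z : (ℝ × ℝ) × ℝ ∂(volume.prod (volume.restrict (Ioi 0))), 0 < z.2 :=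
        Measure.quasiMeasurePreserving_snd.ae (self_mem_ae_restrict measurableSet_Ioi)
      filter_upwards [hξ] with z hz
      obtain ⟨w, ξ⟩ := z
      simp only at hz
      simp only [Function.uncurry_apply_pair, norm_mul, norm_pow, norm_real,
        Real.norm_of_nonneg hz.le, norm_exp, neg_re, re_ofReal_mul, hQre]
      set X := u * (w.1 + b₁.re / (2 * u)) ^ 2
      set Y := v * (w.2 + b₂.re / (2 * v)) ^ 2
      have hX0 : 0 ≤ X := by positivity
      have hY0 : 0 ≤ Y := by positivity
      have hexp : ∀ s : ℝ, 0 < s → Real.exp (-(ξ * s)) ≤ ξ⁻¹ * s⁻¹ := by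
        intro s hs
        rw [Real.exp_neg, ← mul_inv]
        gcongr
        linarith [Real.add_one_le_exp (ξ * s)]
      have hsplit : Real.exp (-(ξ * (η + X + Y))) = Real.exp (-(ξ * (η / 4 + X))) *
          Real.exp (-(ξ * (η / 4 + Y))) * Real.exp (-(η / 2) * ξ) := by
        rw [← Real.exp_add, ← Real.exp_add]
        congr 1
        ring
      rw [hsplit]
      calc ξ ^ 2 * (Real.exp (-(ξ * (η / 4 + X))) *
          Real.exp (-(ξ * (η / 4 + Y))) * Real.exp (-(η / 2) * ξ))
          ≤ ξ ^ 2 * ((ξ⁻¹ * (η / 4 + X)⁻¹) * (ξ⁻¹ * (η / 4 + Y)⁻¹) *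
            Real.exp (-(η / 2) * ξ)) := by
            gcongr
            · exact hexp _ (by positivity)
            · exact hexp _ (by positivity)
        _ = _ := by field_simp
  have hgauss : ∀ ξ ∈ Ioi (0 : ℝ), ∫ w : ℝ × ℝ, (ξ : ℂ) ^ 2 * cexp (-(ξ * Q w)) =
      (Real.pi / √(u * v) : ℝ) * ((ξ : ℂ) ^ 1 * cexp (-(ξ * C'))) := by
    intro ξ hξ
    have hξ : 0 < ξ := hξ
    have hξ0 : (ξ : ℂ) ≠ 0 := by exact_mod_cast hξ.ne'
    have hu0 : (u : ℂ) ≠ 0 := by exact_mod_cast hu.ne'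
    have hv0 : (v : ℂ) ≠ 0 := by exact_mod_cast hv.ne'
    have hg : ∀ (r : ℝ) (b : ℂ), 0 < r → ∫ x : ℝ, cexp (-(ξ * r) * x ^ 2 + -(ξ * b) * x + 0) =
        (√(Real.pi / (ξ * r)) : ℝ) * cexp (ξ * (b ^ 2 / (4 * r))) := by
      intro r b hr
      have hr0 : (r : ℂ) ≠ 0 := by exact_mod_cast hr.ne'
      rw [integral_cexp_quadratic (by simpa using mul_pos hξ hr)]
      congr 1
      · rw [neg_neg, Real.sqrt_eq_rpow, ofReal_cpow (by positivity)]
        push_cast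
        rfl
      · congr 1
        field_simp
        ring
    have hfac : ∀ w : ℝ × ℝ, (ξ : ℂ) ^ 2 * cexp (-(ξ * Q w)) = (ξ : ℂ) ^ 2 * cexp (-(ξ * C)) *
        (cexp (-(ξ * u) * w.1 ^ 2 + -(ξ * b₁) * w.1 + 0) *
          cexp (-(ξ * v) * w.2 ^ 2 + -(ξ * b₂) * w.2 + 0)) := by
      intro w
      rw [mul_assoc, ← Complex.exp_add, ← Complex.exp_add]
      congr 2
      simp only [hQ]
      ring
    simp only [hfac]
    rw [integral_const_mul, Measure.volume_eq_prod,
      integral_prod_mul (fun x : ℝ => cexp (-(ξ * u) * x ^ 2 + -(ξ * b₁) * x + 0))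
      (fun y : ℝ => cexp (-(ξ * v) * y ^ 2 + -(ξ * b₂) * y + 0)), hg u b₁ hu, hg v b₂ hv]
    have hsq : √(Real.pi / (ξ * u)) * √(Real.pi / (ξ * v)) = Real.pi / √(u * v) * ξ⁻¹ := by
      rw [← Real.sqrt_mul (by positivity), show Real.pi / (ξ * u) * (Real.pi / (ξ * v)) =
        (Real.pi * ξ⁻¹) ^ 2 / (u * v) by field_simp, Real.sqrt_div (by positivity),
        Real.sqrt_sq (by positivity)]
      ring
    have hsq' := congrArg (fun r : ℝ => (r : ℂ)) hsq
    simp only [ofReal_mul, ofReal_inv] at hsq'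
    have hexp : cexp (-(ξ * C')) = cexp (-(ξ * C)) * (cexp (ξ * (b₁ ^ 2 / (4 * u))) *
        cexp (ξ * (b₂ ^ 2 / (4 * v)))) := by
      rw [← Complex.exp_add, ← Complex.exp_add]
      congr 1
      rw [hC']
      ring
    rw [hexp]
    generalize cexp (ξ * (b₁ ^ 2 / (4 * u))) = E₁
    generalize cexp (ξ * (b₂ ^ 2 / (4 * v))) = E₂
    generalize cexp (-(ξ * C)) = E₃
    calc _ = (ξ : ℂ) ^ 2 * E₃ * (((√(Real.pi / (ξ * u)) : ℝ) : ℂ) * ((√(Real.pi / (ξ * v)) : ℝ) : ℂ))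
          * (E₁ * E₂) := by ring
      _ = _ := by
        rw [hsq']
        field_simp
  change ∫ w, (Q w ^ 3)⁻¹ = _
  simp only [hcube]
  rw [integral_const_mul, integral_integral_swap hdom, setIntegral_congr_fun measurableSet_Ioi hgauss,
    integral_const_mul, integral_pow_mul_cexp hC'pos]
  push_cast
  simp only [Nat.factorial_one, Nat.cast_one, one_mul]
  ring

end Integrals

/-! ### The kernel on the shells and its Gram matrix -/

section Kernel

open Complex ComplexConjugate

/-- The shear `(x, y, t) ↦ (x, y, t + τ (x, y))` preserves Lebesgue measure. -/
theorem measurePreserving_shear {τ : ℝ → ℝ → ℝ} (hτ : Continuous (Function.uncurry τ)) :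
    MeasurePreserving (fun r : ℝ × ℝ × ℝ => (r.1, r.2.1, r.2.2 + τ r.1 r.2.1)) := by
  refine (MeasurePreserving.id volume).skew_product
    (g := fun x (r : ℝ × ℝ) => (r.1, r.2 + τ x r.1)) ?_ (Eventually.of_forall fun x => ?_)
  · have : Continuous fun r : ℝ × ℝ × ℝ => (r.2.1, r.2.2 + τ r.1 r.2.1) := by
      have h := hτ.comp (by fun_prop : Continuous fun r : ℝ × ℝ × ℝ => (r.1, r.2.1))
      exact (by fun_prop : Continuous fun r : ℝ × ℝ × ℝ => r.2.1).prodMk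
        ((by fun_prop : Continuous fun r : ℝ × ℝ × ℝ => r.2.2).add h)
    exact this.measurable
  · refine ((MeasurePreserving.id volume).skew_product (g := fun y (t : ℝ) => t + τ x y) ?_
      (Eventually.of_forall fun y => (measurePreserving_add_right volume (τ x y)).map_eq)).map_eq
    have h := hτ.comp (by fun_prop : Continuous fun r : ℝ × ℝ => (x, r.1))
    exact ((by fun_prop : Continuous fun r : ℝ × ℝ => r.2).add h).measurable

theorem integral_prod_prod {F : ℝ × ℝ × ℝ → ℂ} (hF : Integrable F) :
    ∫ r, F r = ∫ w : ℝ × ℝ, ∫ t, F (w.1, w.2, t) := by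
  have hmp : MeasurePreserving (MeasurableEquiv.prodAssoc : (ℝ × ℝ) × ℝ ≃ᵐ ℝ × ℝ × ℝ) :=
    volume_preserving_prodAssoc
  rw [← hmp.integral_comp', Measure.volume_eq_prod, integral_prod]
  · rfl
  · exact hmp.integrable_comp_emb (MeasurableEquiv.measurableEmbedding _) |>.2 hF

/-- The denominator of the Leray kernel, up to a factor `2`: the target point is the point of
height `ε` above `p`, the point of integration is `q`. -/
noncomputable def shellDen (β ε : ℝ) (p q : ℝ × ℝ × ℝ) : ℂ :=
  ((1 + β) * (q.1 - p.1) ^ 2 + (1 - β) * (q.2.1 - p.2.1) ^ 2 + ε : ℝ) +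
    (q.2.2 - p.2.2 + 4 * β * q.1 * q.2.1 - 2 * (1 + β) * q.1 * p.2.1
      + 2 * (1 - β) * q.2.1 * p.1 : ℝ) * I

/-- The density of the Leray kernel with respect to `dx dy dt`, the target point being the point
of height `ε` above `p`. -/
noncomputable def shellKernel (β ε : ℝ) (p q : ℝ × ℝ × ℝ) : ℂ :=
  ((Real.pi : ℂ) ^ 2 * shellDen β ε p q ^ 2)⁻¹

/-- The shear of `ℝ³` induced on the boundary by the biholomorphism
`(z₁, z₂) ↦ (z₁, z₂ - i β z₁²)` of `Ω_β` onto `Ω_0`. -/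
noncomputable def twist (β : ℝ) (r : ℝ × ℝ × ℝ) : ℝ × ℝ × ℝ :=
  (r.1, r.2.1, r.2.2 + 2 * β * r.1 * r.2.1)

/-- The Gram matrix of the kernels on two shells whose heights add up to `a`: a multiple of the
Cauchy–Szegő kernel of the Heisenberg group at height `a`, in twisted coordinates. -/
noncomputable def gramKernel (β a : ℝ) (p q : ℝ × ℝ × ℝ) : ℂ :=
  ((√(1 - β ^ 2) : ℝ) : ℂ)⁻¹ * shellKernel 0 a (twist β p) (twist β q)

variable {β ε δ : ℝ}

theorem shellDen_re (p q : ℝ × ℝ × ℝ) : (shellDen β ε p q).re =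
    (1 + β) * (q.1 - p.1) ^ 2 + (1 - β) * (q.2.1 - p.2.1) ^ 2 + ε := by
  simp only [shellDen, add_re, re_ofReal_mul, ofReal_re, I_re, mul_zero, add_zero]

theorem shellDen_im (p q : ℝ × ℝ × ℝ) : (shellDen β ε p q).im =
    q.2.2 - p.2.2 + 4 * β * q.1 * q.2.1 - 2 * (1 + β) * q.1 * p.2.1
      + 2 * (1 - β) * q.2.1 * p.1 := by
  simp only [shellDen, add_im, im_ofReal_mul, ofReal_im, I_im, mul_one, zero_add]

theorem shellDen_re_pos (h₀ : 0 ≤ β) (h₁ : β < 1) (hε : 0 < ε) (p q : ℝ × ℝ × ℝ) :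
    0 < (shellDen β ε p q).re := by
  rw [shellDen_re]
  have := mul_nonneg (by linarith : 0 ≤ 1 + β) (sq_nonneg (q.1 - p.1))
  have := mul_nonneg (by linarith : 0 ≤ 1 - β) (sq_nonneg (q.2.1 - p.2.1))
  linarith

theorem shellDen_ne_zero (h₀ : 0 ≤ β) (h₁ : β < 1) (hε : 0 < ε) (p q : ℝ × ℝ × ℝ) :
    shellDen β ε p q ≠ 0 :=
  ne_zero_of_re_pos (shellDen_re_pos h₀ h₁ hε p q)

theorem continuous_shellKernel (h₀ : 0 ≤ β) (h₁ : β < 1) (hε : 0 < ε) (p : ℝ × ℝ × ℝ) :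
    Continuous (shellKernel β ε p) := by
  refine Continuous.inv₀ ?_ fun q => mul_ne_zero (by simp [Real.pi_ne_zero])
    (pow_ne_zero 2 (shellDen_ne_zero h₀ h₁ hε p q))
  unfold shellDen
  fun_prop

theorem memLp_shellKernel (h₀ : 0 ≤ β) (h₁ : β < 1) (hε : 0 < ε) (p : ℝ × ℝ × ℝ) :
    MemLp (shellKernel β ε p) 2 := by
  have hmeas := (continuous_shellKernel h₀ h₁ hε p).aestronglyMeasurable (μ := volume)
  rw [memLp_two_iff_integrable_sq_norm hmeas]
  have hp : 0 < 1 + β := by linarith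
  have hm : 0 < 1 - β := by linarith
  have hX := integrable_inv_add_mul_sq hε hp (-p.1)
  have hY := integrable_inv_add_mul_sq hε hm (-p.2.1)
  have hT := integrable_inv_add_mul_sq (sq_pos_of_pos hε) one_pos (-p.2.2)
  -- Shearing the last variable makes the bound a product of functions of one variable.
  set τ : ℝ → ℝ → ℝ := fun x y => 4 * β * x * y - 2 * (1 + β) * x * p.2.1 +
    2 * (1 - β) * y * p.1 with hτ
  have hsh := measurePreserving_shear (τ := τ) (by rw [hτ, Function.uncurry_def]; fun_prop)
  have hdom := (hsh.integrable_comp (hX.mul_prod (hY.mul_prod hT)).aestronglyMeasurable).2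
    (hX.mul_prod (hY.mul_prod hT))
  refine (hdom.const_mul ((Real.pi ^ 2)⁻¹ ^ 2)).mono' (hmeas.norm.pow 2)
    (Eventually.of_forall fun q => ?_)
  have hnorm : ‖shellDen β ε p q‖ ^ 2 = ((1 + β) * (q.1 - p.1) ^ 2 + (1 - β) * (q.2.1 - p.2.1) ^ 2
      + ε) ^ 2 + (q.2.2 + τ q.1 q.2.1 - p.2.2) ^ 2 := by
    rw [← normSq_eq_norm_sq, normSq_apply, shellDen_re, shellDen_im]
    ring
  rw [Real.norm_of_nonneg (by positivity), shellKernel, norm_inv, norm_mul, norm_pow, norm_pow,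
    hnorm, norm_real, Real.norm_of_nonneg Real.pi_pos.le, mul_inv, mul_pow]
  simp only [Function.comp_apply, ← sub_eq_add_neg, one_mul]
  gcongr
  rw [← mul_inv, ← mul_inv, inv_pow]
  set X := (1 + β) * (q.1 - p.1) ^ 2
  set Y := (1 - β) * (q.2.1 - p.2.1) ^ 2
  set T := (q.2.2 + τ q.1 q.2.1 - p.2.2) ^ 2
  have hX0 : 0 ≤ X := by positivity
  have hY0 : 0 ≤ Y := by positivity
  have hT0 : 0 ≤ T := by positivity
  gcongr
  have e1 : (ε + X) * (ε + Y) ≤ (X + Y + ε) ^ 2 + T := by nlinarith [mul_nonneg hX0 hY0]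
  have e2 : ε ^ 2 + T ≤ (X + Y + ε) ^ 2 + T := by nlinarith [mul_nonneg hX0 hY0]
  calc (ε + X) * ((ε + Y) * (ε ^ 2 + T)) = (ε + X) * (ε + Y) * (ε ^ 2 + T) := by ring
    _ ≤ ((X + Y + ε) ^ 2 + T) * ((X + Y + ε) ^ 2 + T) := by gcongr
    _ = _ := by ring

theorem conj_shellKernel_zero (p q : ℝ × ℝ × ℝ) :
    conj (shellKernel 0 ε p q) = shellKernel 0 ε q p := by
  have : conj (shellDen 0 ε p q) = shellDen 0 ε q p := by
    apply Complex.ext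
    · rw [conj_re, shellDen_re, shellDen_re]; ring
    · rw [conj_im, shellDen_im, shellDen_im]; ring
  simp only [shellKernel, map_inv₀, map_mul, map_pow, conj_ofReal, this]

/-- The Gram matrix of the kernels on two shells depends on the sum of the heights only, and is
the Gram matrix for `β = 0` up to a factor and a shear. -/
theorem integral_shellKernel_mul_conj (h₀ : 0 ≤ β) (h₁ : β < 1) (hε : 0 < ε) (hδ : 0 < δ)
    (p p' : ℝ × ℝ × ℝ) :
    ∫ r, shellKernel β ε p r * conj (shellKernel β δ p' r) = gramKernel β (ε + δ) p p' := by
  have hint : Integrable fun r => shellKernel β ε p r * conj (shellKernel β δ p' r) :=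
    (memLp_shellKernel h₀ h₁ hε p).integrable_mul (memLp_shellKernel h₀ h₁ hδ p').star
  rw [integral_prod_prod hint]
  obtain ⟨x₀, y₀, s₀⟩ := p
  obtain ⟨x₁, y₁, s₁⟩ := p'
  have hp : 0 < 1 + β := by linarith
  have hm : 0 < 1 - β := by linarith
  have hπ : (Real.pi : ℂ) ≠ 0 := by simp [Real.pi_ne_zero]
  set b₁ : ℂ := -2 * (1 + β) * ((x₀ + x₁ : ℝ) + (y₀ - y₁ : ℝ) * I) with hb₁
  set b₂ : ℂ := -2 * (1 - β) * ((y₀ + y₁ : ℝ) + (x₁ - x₀ : ℝ) * I) with hb₂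
  set C : ℂ := ((1 + β) * (x₀ ^ 2 + x₁ ^ 2) + (1 - β) * (y₀ ^ 2 + y₁ ^ 2) + (ε + δ) : ℝ) +
    (s₁ - s₀ : ℝ) * I with hC
  have hb₁re : b₁.re = -2 * (1 + β) * (x₀ + x₁) := by
    rw [hb₁, show (-2 * (1 + β) : ℂ) = ((-2 * (1 + β) : ℝ) : ℂ) by push_cast; rfl, re_ofReal_mul]
    simp
  have hb₂re : b₂.re = -2 * (1 - β) * (y₀ + y₁) := by
    rw [hb₂, show (-2 * (1 - β) : ℂ) = ((-2 * (1 - β) : ℝ) : ℂ) by push_cast; rfl, re_ofReal_mul]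
    simp
  have hCre : C.re = (1 + β) * (x₀ ^ 2 + x₁ ^ 2) + (1 - β) * (y₀ ^ 2 + y₁ ^ 2) + (ε + δ) := by
    simp only [hC, add_re, ofReal_re, re_ofReal_mul, I_re, mul_zero, add_zero]
  have hpos : 0 < C.re - b₁.re ^ 2 / (4 * (2 * (1 + β))) - b₂.re ^ 2 / (4 * (2 * (1 - β))) := by
    have : C.re - b₁.re ^ 2 / (4 * (2 * (1 + β))) - b₂.re ^ 2 / (4 * (2 * (1 - β))) =
        (1 + β) * (x₀ - x₁) ^ 2 / 2 + (1 - β) * (y₀ - y₁) ^ 2 / 2 + (ε + δ) := by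
      rw [hCre, hb₁re, hb₂re]
      field_simp
      ring
    rw [this]
    positivity
  have hinner : ∀ w : ℝ × ℝ, ∫ t : ℝ, shellKernel β ε (x₀, y₀, s₀) (w.1, w.2, t) *
      conj (shellKernel β δ (x₁, y₁, s₁) (w.1, w.2, t)) = 4 * ((Real.pi : ℂ) ^ 3)⁻¹ *
        ((((2 * (1 + β) : ℝ) : ℂ) * w.1 ^ 2 + ((2 * (1 - β) : ℝ) : ℂ) * w.2 ^ 2 + b₁ * w.1 +
          b₂ * w.2 + C) ^ 3)⁻¹ := by
    intro w
    set a := shellDen β ε (x₀, y₀, s₀) (w.1, w.2, 0) with ha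
    set b := conj (shellDen β δ (x₁, y₁, s₁) (w.1, w.2, 0)) with hb
    have hare : 0 < a.re := shellDen_re_pos h₀ h₁ hε _ _
    have hbre : 0 < b.re := by rw [hb, conj_re]; exact shellDen_re_pos h₀ h₁ hδ _ _
    have hat : ∀ t : ℝ, shellDen β ε (x₀, y₀, s₀) (w.1, w.2, t) = a + t * I := by
      intro t
      simp only [ha, shellDen]
      push_cast
      ring
    have hbt : ∀ t : ℝ, conj (shellDen β δ (x₁, y₁, s₁) (w.1, w.2, t)) = b - t * I := by
      intro t
      simp only [hb, shellDen, map_add, map_mul, conj_ofReal, conj_I]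
      push_cast
      ring
    have hab : a + b = ((2 * (1 + β) : ℝ) : ℂ) * w.1 ^ 2 + ((2 * (1 - β) : ℝ) : ℂ) * w.2 ^ 2 +
        b₁ * w.1 + b₂ * w.2 + C := by
      simp only [ha, hb, hb₁, hb₂, hC, shellDen, map_add, map_mul, conj_ofReal, conj_I]
      push_cast
      ring
    have : ∀ t : ℝ, shellKernel β ε (x₀, y₀, s₀) (w.1, w.2, t) *
        conj (shellKernel β δ (x₁, y₁, s₁) (w.1, w.2, t)) =
        ((Real.pi : ℂ) ^ 4)⁻¹ * (((a + t * I) ^ 2)⁻¹ * ((b - t * I) ^ 2)⁻¹) := by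
      intro t
      simp only [shellKernel, map_inv₀, map_mul, map_pow, conj_ofReal, hat, hbt, mul_inv]
      ring
    simp only [this]
    rw [integral_const_mul, integral_inv_sq_mul_inv_sq hare hbre, ← hab]
    field_simp
  simp only [hinner]
  rw [integral_const_mul, integral_inv_quadratic_cube (by positivity) (by positivity) b₁ b₂ C hpos]
  have hsqrt : √(2 * (1 + β) * (2 * (1 - β))) = 2 * √(1 - β ^ 2) := by
    rw [show 2 * (1 + β) * (2 * (1 - β)) = 2 ^ 2 * (1 - β ^ 2) by ring,
      Real.sqrt_mul (by positivity), Real.sqrt_sq (by positivity)]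
  have hden : C - b₁ ^ 2 / (4 * (2 * (1 + β) : ℝ)) - b₂ ^ 2 / (4 * (2 * (1 - β) : ℝ)) =
      shellDen 0 (ε + δ) (twist β (x₀, y₀, s₀)) (twist β (x₁, y₁, s₁)) := by
    have hpc : (1 + β : ℂ) ≠ 0 := by exact_mod_cast hp.ne'
    have hmc : (1 - β : ℂ) ≠ 0 := by exact_mod_cast hm.ne'
    have e1 : b₁ ^ 2 / (4 * (2 * (1 + β) : ℝ)) =
        (1 + β) / 2 * ((x₀ + x₁ : ℝ) + (y₀ - y₁ : ℝ) * I) ^ 2 := by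
      rw [hb₁]
      push_cast
      field_simp
      ring
    have e2 : b₂ ^ 2 / (4 * (2 * (1 - β) : ℝ)) =
        (1 - β) / 2 * ((y₀ + y₁ : ℝ) + (x₁ - x₀ : ℝ) * I) ^ 2 := by
      rw [hb₂]
      push_cast
      field_simp
      ring
    rw [e1, e2, hC]
    simp only [shellDen, twist]
    push_cast
    linear_combination (-(1 + β) / 2 * (y₀ - y₁) ^ 2 - (1 - β) / 2 * (x₁ - x₀) ^ 2 : ℂ) * I_sq
  rw [hden, gramKernel, shellKernel, hsqrt]
  have hs : ((√(1 - β ^ 2) : ℝ) : ℂ) ≠ 0 := by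
    have : 0 < √(1 - β ^ 2) := Real.sqrt_pos.2 (by nlinarith)
    exact_mod_cast this.ne'
  push_cast
  field_simp
  ring

theorem measurePreserving_twist (β : ℝ) : MeasurePreserving (twist β) :=
  measurePreserving_shear (τ := fun x y => 2 * β * x * y) (by rw [Function.uncurry_def]; fun_prop)

theorem memLp_gramKernel (hε : 0 < ε) (q : ℝ × ℝ × ℝ) :
    MemLp (fun p => gramKernel β ε p q) 2 := by
  have h := ((memLp_shellKernel le_rfl one_pos hε (twist β q)).comp_measurePreserving
    (measurePreserving_twist β)).star.const_mul ((√(1 - β ^ 2) : ℝ) : ℂ)⁻¹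
  refine h.ae_eq (Eventually.of_forall fun p => ?_)
  simp only [gramKernel, ← conj_shellKernel_zero (twist β q) (twist β p), Pi.star_apply,
    Function.comp_apply, starRingEnd_apply]

theorem integral_conj_gramKernel_mul (hε : 0 < ε) (hδ : 0 < δ) (p q : ℝ × ℝ × ℝ) :
    ∫ r, conj (gramKernel β ε r p) * gramKernel β δ r q =
      ((√(1 - β ^ 2) : ℝ) : ℂ)⁻¹ * gramKernel β (ε + δ) p q := by
  have h1 : ∀ r, conj (gramKernel β ε r p) * gramKernel β δ r q =
      (((√(1 - β ^ 2) : ℝ) : ℂ)⁻¹) ^ 2 * (shellKernel 0 ε (twist β p) (twist β r) *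
        conj (shellKernel 0 δ (twist β q) (twist β r))) := by
    intro r
    simp only [gramKernel, map_mul, conj_shellKernel_zero, map_inv₀, conj_ofReal]
    ring
  have hc : Continuous fun r => shellKernel 0 ε (twist β p) r *
      conj (shellKernel 0 δ (twist β q) r) :=
    (continuous_shellKernel le_rfl one_pos hε _).mul
      (continuous_conj.comp (continuous_shellKernel le_rfl one_pos hδ _))
  have h2 := integral_map (measurePreserving_twist β).aemeasurable
    (f := fun r => shellKernel 0 ε (twist β p) r * conj (shellKernel 0 δ (twist β q) r))
    hc.aestronglyMeasurable
  rw [(measurePreserving_twist β).map_eq] at h2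
  simp only [h1]
  rw [integral_const_mul, ← h2, integral_shellKernel_mul_conj le_rfl one_pos hε hδ]
  simp only [gramKernel, twist]
  norm_num
  ring

theorem gramKernel_self (a : ℝ) (p : ℝ × ℝ × ℝ) : gramKernel β a p p =
    ((√(1 - β ^ 2) : ℝ) : ℂ)⁻¹ * ((Real.pi : ℂ) ^ 2 * (a : ℂ) ^ 2)⁻¹ := by
  have : shellDen 0 a (twist β p) (twist β p) = a := by
    apply Complex.ext
    · rw [shellDen_re, ofReal_re]; ring
    · rw [shellDen_im, ofReal_im]; ring
  rw [gramKernel, shellKernel, this]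

/-- The boundary value operator on `L²(ℝ³)`. -/
theorem exists_shell_boundary_operator (h₀ : 0 ≤ β) (h₁ : β < 1) :
    ∃ L : Lp ℂ 2 (volume : Measure (ℝ × ℝ × ℝ)) →L[ℂ] Lp ℂ 2 (volume : Measure (ℝ × ℝ × ℝ)),
      ‖L‖ = 1 / (1 - β ^ 2) ^ (1 / 4 : ℝ) ∧ ∀ f : Lp ℂ 2 (volume : Measure (ℝ × ℝ × ℝ)),
      (∀ ε, 0 < ε → MemLp (fun p => ∫ r, f r * shellKernel β ε p r) 2) ∧
      Tendsto (fun ε : ℝ => eLpNorm ((fun p => ∫ r, f r * shellKernel β ε p r) -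
        (L f : ℝ × ℝ × ℝ → ℂ)) 2) (𝓝[>] 0) (𝓝 0) := by
  have hβ : 0 < 1 - β ^ 2 := by nlinarith
  have hs : 0 < √(1 - β ^ 2) := Real.sqrt_pos.2 hβ
  have hsc : ((√(1 - β ^ 2) : ℝ) : ℂ) ≠ 0 := by exact_mod_cast hs.ne'
  have hπ : (Real.pi : ℂ) ≠ 0 := by simp [Real.pi_ne_zero]
  set c : ℝ := 1 / (1 - β ^ 2) ^ (1 / 4 : ℝ) with hc
  have hc2 : c ^ 2 = (√(1 - β ^ 2))⁻¹ := by
    rw [hc, div_pow, one_pow, one_div, ← Real.rpow_natCast, ← Real.rpow_mul hβ.le,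
      Real.sqrt_eq_rpow]
    norm_num
  have hc2' : (c : ℂ) ^ 2 = ((√(1 - β ^ 2) : ℝ) : ℂ)⁻¹ := by
    rw [← ofReal_pow, hc2, ofReal_inv]
  -- Heights `ε ≤ 0` play no role; the vectors are `0` there.
  let κ : ℝ → ℝ × ℝ × ℝ → Lp ℂ 2 (volume : Measure (ℝ × ℝ × ℝ)) := fun ε p =>
    if hε : 0 < ε then (memLp_shellKernel h₀ h₁ hε p).star.toLp _ else 0
  let γ : ℝ → ℝ × ℝ × ℝ → Lp ℂ 2 (volume : Measure (ℝ × ℝ × ℝ)) := fun ε p =>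
    if hε : 0 < ε then (memLp_gramKernel (β := β) hε p).toLp _ else 0
  have hκe : ∀ ε p, 0 < ε → κ ε p =ᵐ[volume] fun r => conj (shellKernel β ε p r) := by
    intro ε p hε
    simp only [κ, dif_pos hε]
    exact MemLp.coeFn_toLp _
  have hγe : ∀ ε p, 0 < ε → γ ε p =ᵐ[volume] fun r => gramKernel β ε r p := by
    intro ε p hε
    simp only [γ, dif_pos hε]
    exact MemLp.coeFn_toLp _
  have hinner : ∀ ε p, 0 < ε → ∀ f : Lp ℂ 2 (volume : Measure (ℝ × ℝ × ℝ)),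
      inner ℂ (κ ε p) f = ∫ r, f r * shellKernel β ε p r := by
    intro ε p hε f
    rw [L2.inner_def]
    refine integral_congr_ae ?_
    filter_upwards [hκe ε p hε] with r hr
    rw [hr, RCLike.inner_apply, conj_conj]
  obtain ⟨L, hL, hLf⟩ := exists_boundary_operator (κ := κ) (γ := γ) (g := gramKernel β) (c := c)
    (by positivity) (fun ε δ hε hδ p q => by
      rw [hinner ε p hε, ← integral_shellKernel_mul_conj h₀ h₁ hε hδ]
      refine integral_congr_ae ?_
      filter_upwards [hκe δ q hδ] with r hr
      rw [hr, mul_comm])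
    (fun ε δ hε hδ p q => by
      rw [hc2', ← integral_conj_gramKernel_mul hε hδ, L2.inner_def]
      refine integral_congr_ae ?_
      filter_upwards [hγe ε p hε, hγe δ q hδ] with r hr hr'
      rw [hr, hr', RCLike.inner_apply, mul_comm])
    (fun a q ha => hγe a q ha)
    (fun a b p ha hab => by
      have hb : 0 < b := ha.trans_le hab
      rw [gramKernel_self, gramKernel_self]
      simp only [norm_mul, norm_inv, norm_pow, norm_real, Real.norm_of_nonneg ha.le,
        Real.norm_of_nonneg hb.le]
      have : 0 < ‖Real.pi‖ := norm_pos_iff.2 Real.pi_ne_zero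
      gcongr)
    (fun a p ha => by
      have : (a : ℂ) ≠ 0 := by exact_mod_cast ha.ne'
      rw [gramKernel_self]
      exact mul_ne_zero (inv_ne_zero hsc) (inv_ne_zero (mul_ne_zero (pow_ne_zero 2 hπ)
        (pow_ne_zero 2 this))))
    (fun a p ha => by
      have : (a : ℂ) ≠ 0 := by exact_mod_cast ha.ne'
      simp only [gramKernel_self]
      exact ContinuousAt.mul continuousAt_const (ContinuousAt.inv₀ (by fun_prop)
        (mul_ne_zero (pow_ne_zero 2 hπ) (pow_ne_zero 2 this))))
  refine ⟨L, hL, fun f => ⟨fun ε hε => ?_, ?_⟩⟩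
  · simpa only [hinner ε _ hε] using (hLf f).1 ε hε
  · refine (hLf f).2.congr' ?_
    filter_upwards [self_mem_nhdsWithin] with ε hε
    simp only [hinner ε _ hε]

end Kernel

/-! ### The Leray kernel in coordinates -/

section LerayKernel

open Complex

theorem modelRho_eq (β : ℝ) (w : Fin 2 → ℂ) :
    modelRho β w = (1 + β) * (w 0).re ^ 2 + (1 - β) * (w 0).im ^ 2 - (w 1).im := by
  rw [modelRho, ← normSq_eq_norm_sq, normSq_apply, sq (w 0), mul_re]
  ring

theorem fderiv_modelRho (β : ℝ) (ζ v : Fin 2 → ℂ) :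
    fderiv ℝ (fun w => (modelRho β w : ℂ)) ζ v =
      (2 * (1 + β) * (ζ 0).re * (v 0).re + 2 * (1 - β) * (ζ 0).im * (v 0).im - (v 1).im : ℝ) := by
  have hre : ∀ i, DifferentiableAt ℝ (fun w : Fin 2 → ℂ => (w i).re) ζ := fun i =>
    reCLM.differentiableAt.comp ζ (differentiableAt_apply i ζ)
  have him : ∀ i, DifferentiableAt ℝ (fun w : Fin 2 → ℂ => (w i).im) ζ := fun i =>
    imCLM.differentiableAt.comp ζ (differentiableAt_apply i ζ)
  have hd : DifferentiableAt ℝ (fun w => (modelRho β w : ℂ)) ζ := by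
    simp only [modelRho_eq]
    exact ofRealCLM.differentiableAt.comp ζ
      (((((hre 0).pow 2).const_mul _).add (((him 0).pow 2).const_mul _)).sub (him 1))
  rw [← hd.lineDeriv_eq_fderiv, lineDeriv]
  refine HasDerivAt.deriv ?_
  simp only [modelRho_eq]
  refine HasDerivAt.ofReal_comp ?_
  simp only [Pi.add_apply, Pi.smul_apply, add_re, add_im, real_smul, re_ofReal_mul, im_ofReal_mul]
  have h : ∀ a b : ℝ, HasDerivAt (fun t : ℝ => a + t * b) b 0 := fun a b => by
    simpa using ((hasDerivAt_id (0 : ℝ)).mul_const b).const_add a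
  refine ((((h (ζ 0).re (v 0).re).fun_pow 2).const_mul (1 + β)).add
    (((h (ζ 0).im (v 0).im).fun_pow 2).const_mul (1 - β)) |>.sub (h (ζ 1).im (v 1).im)).congr_deriv ?_
  simp
  ring

theorem wirtinger_modelRho_zero (β : ℝ) :
    wirtinger 0 (fun w => (modelRho β w : ℂ)) =
      fun ζ => ((1 + β) * (ζ 0).re : ℝ) - ((1 - β) * (ζ 0).im : ℝ) * I := by
  funext ζ
  rw [wirtinger, fderiv_modelRho, fderiv_modelRho]
  simp
  ring

theorem wirtinger_modelRho_one (β : ℝ) :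
    wirtinger 1 (fun w => (modelRho β w : ℂ)) = fun _ => I / 2 := by
  funext ζ
  rw [wirtinger, fderiv_modelRho, fderiv_modelRho]
  simp

theorem fderiv_wirtinger_modelRho_zero (β : ℝ) (ζ v : Fin 2 → ℂ) :
    fderiv ℝ (wirtinger 0 (fun w => (modelRho β w : ℂ))) ζ v =
      ((1 + β) * (v 0).re : ℝ) - ((1 - β) * (v 0).im : ℝ) * I := by
  rw [wirtinger_modelRho_zero]
  have hre : HasFDerivAt (fun w : Fin 2 → ℂ => (((1 + β) * (w 0).re : ℝ) : ℂ))
      (ofRealCLM.comp ((1 + β) • reCLM.comp (ContinuousLinearMap.proj 0))) ζ :=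
    (ofRealCLM.comp ((1 + β) • reCLM.comp
      (ContinuousLinearMap.proj (R := ℝ) (φ := fun _ : Fin 2 => ℂ) 0))).hasFDerivAt
  have him : HasFDerivAt (fun w : Fin 2 → ℂ => (((1 - β) * (w 0).im : ℝ) : ℂ))
      (ofRealCLM.comp ((1 - β) • imCLM.comp (ContinuousLinearMap.proj 0))) ζ :=
    (ofRealCLM.comp ((1 - β) • imCLM.comp
      (ContinuousLinearMap.proj (R := ℝ) (φ := fun _ : Fin 2 => ℂ) 0))).hasFDerivAt
  rw [(hre.fun_sub (him.mul_const I)).fderiv]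
  simp
  ring

theorem dRho_modelRho (β : ℝ) (ζ v : Fin 2 → ℂ) : dRho (modelRho β) ζ v =
    (((1 + β) * (ζ 0).re : ℝ) - ((1 - β) * (ζ 0).im : ℝ) * I) * v 0 + I / 2 * v 1 := by
  rw [dRho, Fin.sum_univ_two, wirtinger_modelRho_zero, wirtinger_modelRho_one]

theorem dBarDRho_modelRho (β : ℝ) (ζ u v : Fin 2 → ℂ) :
    dBarDRho (modelRho β) ζ u v = star (u 0) * v 0 - star (v 0) * u 0 := by
  have h00 : wirtingerBar 0 (wirtinger 0 (fun w => (modelRho β w : ℂ))) ζ = 1 := by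
    rw [wirtingerBar, fderiv_wirtinger_modelRho_zero, fderiv_wirtinger_modelRho_zero]
    simp
    linear_combination (-(1 - β) / 2 : ℂ) * I_sq
  have h10 : wirtingerBar 1 (wirtinger 0 (fun w => (modelRho β w : ℂ))) ζ = 0 := by
    rw [wirtingerBar, fderiv_wirtinger_modelRho_zero, fderiv_wirtinger_modelRho_zero]
    simp
  have h1 : ∀ k, wirtingerBar k (wirtinger 1 (fun w => (modelRho β w : ℂ))) ζ = 0 := by
    intro k
    rw [wirtingerBar, wirtinger_modelRho_one]
    simp
  simp only [dBarDRho, Fin.sum_univ_two, h00, h10, h1]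
  ring

theorem modelGraph_eq (β : ℝ) (p : ℝ × ℝ × ℝ) : modelGraph β p =
    ![(p.1 : ℂ) + p.2.1 * I,
      (p.2.2 : ℂ) + ((1 + β) * p.1 ^ 2 + (1 - β) * p.2.1 ^ 2 : ℝ) * I] := by
  have h : ‖(⟨p.1, p.2.1⟩ : ℂ)‖ ^ 2 + β * ((⟨p.1, p.2.1⟩ : ℂ) ^ 2).re =
      (1 + β) * p.1 ^ 2 + (1 - β) * p.2.1 ^ 2 := by
    rw [← normSq_eq_norm_sq, normSq_apply, sq, mul_re]
    ring
  rw [modelGraph, h, mk_eq_add_mul_I, mk_eq_add_mul_I]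

theorem fderiv_modelGraph (β : ℝ) (p v : ℝ × ℝ × ℝ) : fderiv ℝ (modelGraph β) p v =
    ![(v.1 : ℂ) + v.2.1 * I, (v.2.2 : ℂ) +
      (2 * (1 + β) * p.1 * v.1 + 2 * (1 - β) * p.2.1 * v.2.1 : ℝ) * I] := by
  have hd : DifferentiableAt ℝ (modelGraph β) p := by
    rw [show modelGraph β = _ from funext (modelGraph_eq β), differentiableAt_pi]
    have h : ∀ f : ℝ × ℝ × ℝ → ℝ, Differentiable ℝ f →
        DifferentiableAt ℝ (fun q => (f q : ℂ)) p := fun f hf =>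
      ofRealCLM.differentiableAt.comp p (hf p)
    intro i
    fin_cases i
    · exact (h (fun q => q.1) (by fun_prop)).add ((h (fun q => q.2.1) (by fun_prop)).mul_const I)
    · exact (h (fun q => q.2.2) (by fun_prop)).add
        ((h (fun q => (1 + β) * q.1 ^ 2 + (1 - β) * q.2.1 ^ 2) (by fun_prop)).mul_const I)
  rw [← hd.lineDeriv_eq_fderiv, lineDeriv]
  refine HasDerivAt.deriv ?_
  rw [show modelGraph β = _ from funext (modelGraph_eq β), hasDerivAt_pi]
  have h : ∀ a b : ℝ, HasDerivAt (fun t : ℝ => a + t * b) b 0 := fun a b => by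
    simpa using ((hasDerivAt_id (0 : ℝ)).mul_const b).const_add a
  intro i
  fin_cases i
  · exact (h p.1 v.1).ofReal_comp.add ((h p.2.1 v.2.1).ofReal_comp.mul_const I)
  · refine ((h p.2.2 v.2.2).ofReal_comp.add ((((((h p.1 v.1).fun_pow 2).const_mul (1 + β)).add
      (((h p.2.1 v.2.1).fun_pow 2).const_mul (1 - β))).ofReal_comp).mul_const I)).congr_deriv ?_
    simp
    ring

/-- On the shell of height `ε` the Leray form is `shellKernel` times `dx dy dt`. -/
theorem lerayIntegrand_shell (β : ℝ) (f : modelHypersurface β → ℂ) (ε : ℝ) (p q : ℝ × ℝ × ℝ) :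
    lerayIntegrand β f (modelGraph β p + ![0, ε * I]) q =
      f (modelParam β q) * shellKernel β ε p q := by
  rw [lerayIntegrand, lerayKernel]
  congr 1
  have hden : dRho (modelRho β) (modelGraph β q)
      (modelGraph β q - (modelGraph β p + ![0, ε * I])) = shellDen β ε p q / 2 := by
    rw [dRho_modelRho]
    simp only [modelGraph_eq, shellDen]
    apply Complex.ext <;> simp [pow_two] <;> ring
  have hnum : dRho (modelRho β) (modelGraph β q) (fderiv ℝ (modelGraph β) q (1, 0, 0)) *
        dBarDRho (modelRho β) (modelGraph β q) (fderiv ℝ (modelGraph β) q (0, 1, 0))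
          (fderiv ℝ (modelGraph β) q (0, 0, 1)) -
      dRho (modelRho β) (modelGraph β q) (fderiv ℝ (modelGraph β) q (0, 1, 0)) *
        dBarDRho (modelRho β) (modelGraph β q) (fderiv ℝ (modelGraph β) q (1, 0, 0))
          (fderiv ℝ (modelGraph β) q (0, 0, 1)) +
      dRho (modelRho β) (modelGraph β q) (fderiv ℝ (modelGraph β) q (0, 0, 1)) *
        dBarDRho (modelRho β) (modelGraph β q) (fderiv ℝ (modelGraph β) q (1, 0, 0))
          (fderiv ℝ (modelGraph β) q (0, 1, 0)) = -1 := by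
    simp only [dRho_modelRho, dBarDRho_modelRho, fderiv_modelGraph]
    simp
    linear_combination I_sq
  rw [hden, hnum, shellKernel]
  have h2 : (2 * (Real.pi : ℂ) * I) ^ 2 = -(4 * (Real.pi : ℂ) ^ 2) := by
    rw [mul_pow, I_sq]; ring
  rw [h2, mul_inv, div_pow]
  ring

end LerayKernel

/-! ### The Leray transform -/

section Transform

open Complex

theorem continuous_modelGraph (β : ℝ) : Continuous (modelGraph β) := by
  rw [show modelGraph β = _ from funext (modelGraph_eq β)]
  refine continuous_pi fun i => ?_
  fin_cases i
  · change Continuous fun p : ℝ × ℝ × ℝ => (p.1 : ℂ) + p.2.1 * I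
    fun_prop
  · change Continuous fun p : ℝ × ℝ × ℝ =>
      (p.2.2 : ℂ) + ((1 + β) * p.1 ^ 2 + (1 - β) * p.2.1 ^ 2 : ℝ) * I
    fun_prop

/-- The parametrization of `S_β` as a measurable equivalence. -/
noncomputable def modelEquiv (β : ℝ) : ℝ × ℝ × ℝ ≃ᵐ modelHypersurface β where
  toFun := modelParam β
  invFun ζ := (((ζ : Fin 2 → ℂ) 0).re, ((ζ : Fin 2 → ℂ) 0).im, ((ζ : Fin 2 → ℂ) 1).re)
  left_inv p := by simp [modelParam, modelGraph]
  right_inv ζ := by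
    obtain ⟨ζ, hζ⟩ := ζ
    apply Subtype.ext
    funext i
    fin_cases i
    · simp [modelParam, modelGraph]
    · apply Complex.ext
      · simp [modelParam, modelGraph]
      · simpa [modelParam, modelGraph] using hζ.symm
  measurable_toFun := ((continuous_modelGraph β).subtype_mk _).measurable
  measurable_invFun := by
    have h : ∀ i, Continuous fun ζ : modelHypersurface β => (ζ : Fin 2 → ℂ) i := fun i =>
      (continuous_apply i).comp continuous_subtype_val
    exact ((continuous_re.comp (h 0)).prodMk ((continuous_im.comp (h 0)).prodMk
      (continuous_re.comp (h 1)))).measurable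

theorem measurePreserving_modelEquiv (β : ℝ) :
    MeasurePreserving (modelEquiv β) volume (modelMeasure β) :=
  ⟨(modelEquiv β).measurable, rfl⟩

/-- Every point of `Ω_β` lies above a point of `S_β`. -/
theorem exists_eq_modelGraph_add {β : ℝ} {z : Fin 2 → ℂ} (hz : z ∈ modelDomain β) :
    ∃ p ε, 0 < ε ∧ z = modelGraph β p + ![0, ((ε : ℝ) : ℂ) * I] := by
  obtain ⟨r, hr⟩ : ∃ r : ℝ, r = ‖z 0‖ ^ 2 + β * (z 0 ^ 2).re := ⟨_, rfl⟩
  refine ⟨((z 0).re, (z 0).im, (z 1).re), (z 1).im - r, sub_pos.2 (hr ▸ hz), ?_⟩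
  funext i
  fin_cases i
  · simp [modelGraph]
  · apply Complex.ext <;> simp [modelGraph, ← hr]

end Transform

theorem theorem1p1 (β : ℝ) (hβ₀ : 0 ≤ β) (hβ₁ : β < 1) :
    ∃ L : Lp ℂ 2 (modelMeasure β) →L[ℂ] Lp ℂ 2 (modelMeasure β),
      IsLerayTransform β L ∧ ‖L‖ = 1 / (1 - β ^ 2) ^ (1 / 4 : ℝ) := by
  obtain ⟨T, hT, hTf⟩ := exists_shell_boundary_operator hβ₀ hβ₁
  have he := measurePreserving_modelEquiv β
  have he' := he.symm
  have hmem : ∀ F : modelHypersurface β → ℂ, MemLp (F ∘ modelEquiv β) 2 →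
      MemLp F 2 (modelMeasure β) := fun F hF =>
    (modelEquiv β).measurableEmbedding.memLp_map_measure_iff.2 hF
  have hnorm : ∀ F : modelHypersurface β → ℂ,
      eLpNorm F 2 (modelMeasure β) = eLpNorm (F ∘ modelEquiv β) 2 := fun F =>
    (modelEquiv β).measurableEmbedding.eLpNorm_map_measure
  -- `U` and `V` transport `L²` between `S_β` and `ℝ³`; the transform is `V ∘ T ∘ U`.
  let U := Lp.compMeasurePreservingₗᵢ (E := ℂ) (p := 2) ℂ (modelEquiv β) he
  let V := Lp.compMeasurePreservingₗᵢ (E := ℂ) (p := 2) ℂ (modelEquiv β).symm he'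
  have hU : ∀ f, (U f : ℝ × ℝ × ℝ → ℂ) =ᵐ[volume] f ∘ modelEquiv β := fun f =>
    Lp.coeFn_compMeasurePreserving f he
  have hV : ∀ f, (V f : modelHypersurface β → ℂ) =ᵐ[modelMeasure β] f ∘ (modelEquiv β).symm :=
    fun f => Lp.coeFn_compMeasurePreserving f he'
  have hVe : ∀ f, (V f : modelHypersurface β → ℂ) ∘ modelEquiv β =ᵐ[volume] f := by
    intro f
    filter_upwards [he.quasiMeasurePreserving.ae (hV f)] with p hp
    simp [hp]
  have hUV : ∀ f, U (V f) = f := fun f => Lp.ext ((hU _).trans (hVe f))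
  refine ⟨V.toContinuousLinearMap.comp (T.comp U.toContinuousLinearMap), fun f => ?_, ?_⟩
  · have hint : ∀ p ε, 0 < ε →
        Integrable (lerayIntegrand β f (modelGraph β p + ![0, ((ε : ℝ) : ℂ) * Complex.I])) ∧
        lerayIntegral β f (modelGraph β p + ![0, ((ε : ℝ) : ℂ) * Complex.I]) =
          ∫ r, U f r * shellKernel β ε p r := by
      intro p ε hε
      have hae : (fun r => U f r * shellKernel β ε p r) =ᵐ[volume]
          lerayIntegrand β f (modelGraph β p + ![0, ((ε : ℝ) : ℂ) * Complex.I]) := by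
        filter_upwards [hU f] with r hr
        rw [lerayIntegrand_shell, hr]
        rfl
      exact ⟨((Lp.memLp (U f)).integrable_mul (memLp_shellKernel hβ₀ hβ₁ hε p)).congr hae,
        (integral_congr_ae hae).symm⟩
    have hshell : ∀ ε, 0 < ε → shellRestrict β (lerayIntegral β f) ε ∘ modelEquiv β =
        fun p => ∫ r, U f r * shellKernel β ε p r := by
      intro ε hε
      funext p
      exact (hint p ε hε).2
    refine ⟨fun z hz => ?_, fun ε hε => ?_, ?_⟩
    · obtain ⟨p, ε, hε, rfl⟩ := exists_eq_modelGraph_add hz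
      exact (hint p ε hε).1
    · refine hmem _ ?_
      rw [hshell ε hε]
      exact (hTf (U f)).1 ε hε
    · refine (hTf (U f)).2.congr' ?_
      filter_upwards [self_mem_nhdsWithin] with ε hε
      rw [hnorm]
      refine eLpNorm_congr_ae ?_
      have h := congrFun (hshell ε hε)
      filter_upwards [hVe (T (U f))] with p hp
      simp only [Pi.sub_apply, Function.comp_apply] at h hp ⊢
      rw [h p]
      exact congrArg _ hp.symm
  · rw [← hT]
    refine le_antisymm (ContinuousLinearMap.opNorm_le_bound _ (norm_nonneg _) fun f => ?_)
      (ContinuousLinearMap.opNorm_le_bound _ (norm_nonneg _) fun f => ?_)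
    · calc ‖V (T (U f))‖ = ‖T (U f)‖ := V.norm_map _
        _ ≤ ‖T‖ * ‖U f‖ := T.le_opNorm _
        _ = ‖T‖ * ‖f‖ := by rw [U.norm_map]
    · have h := (V.toContinuousLinearMap.comp (T.comp U.toContinuousLinearMap)).le_opNorm (V f)
      simp only [ContinuousLinearMap.comp_apply, LinearIsometry.coe_toContinuousLinearMap,
        V.norm_map, hUV] at h
      exact h
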